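/- Let $\mathbb F=\mathbb R$ or $\mathbb C$, let $G$ be a topological group, $X$ a compact metric space, $\zeta:P\to X$ a (locally trivial) principal $G$-bundle, and $B$ a not necessarily unital Banach algebra over $\mathbb F$ on which $G$ acts by $\mathbb F$-algebra automorphisms, the action $G\times B\to B$ being continuous. Let $B^+=\mathbb F\oplus B$ be the unitization of $B$, with $G$ acting trivially on $\mathbb F$, and let $A_\zeta=\Gamma(X,P\times_G B)$ and $A_{\zeta^+}=\Gamma(X,P\times_G B^+)$ be the Banach algebras of continuous sections. Let $GL(A_{\zeta^+})$ be the group of invertible elements of $A_{\zeta^+}$, let $GL(A_\zeta)=\ker[GL((A_\zeta)^+)\to GL(\mathbb F)]$, where $(A_\zeta)^+=\mathbb F\oplus A_\zeta$, and let $GL_o$ denote the path component of the identity. The inclusion $A_\zeta\to A_{\zeta^+}$ induces $\iota:GL(A_\zeta)\to GL(A_{\zeta^+})$, the projection $B^+\to\mathbb F$ induces $p_*:GL(A_{\zeta^+})\to C(X,\mathbb F\setminus\{0\})$, and $\sigma(f)=f\cdot 1$ defines a homomorphism $\sigma:C(X,\mathbb F\setminus\{0\})\to GL(A_{\zeta^+})$.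 (1) Let $\mathbb F=\mathbb C$. There are isomorphisms $\theta_j:\pi_j(C(X,\mathbb C\setminus\{0\}))\cong\check H^{1-j}(X;\mathbb Z)$ for $j=0,1$ (unreduced Čech cohomology), natural with respect to continuous maps of compact metric spaces, such that for all $G,X,\zeta,B$ as above and $j=0,1$ $$0\to\pi_j(GL(A_\zeta))\xrightarrow{\ \iota_*\ }\pi_j(GL(A_{\zeta^+}))\xrightarrow{\ \theta_j\circ\pi_j(p_*)\ }\check H^{1-j}(X;\mathbb Z)\to 0$$ is a short exact sequence of groups, split by the homomorphism $\pi_j(\sigma)\circ\theta_j^{-1}$. The sequence and its splitting are natural with respect to maps of principal $G$-bundles (pullbacks) and continuous $G$-equivariant algebra homomorphisms $B\to B'$. (2) If $j\ge 2$, or if $\mathbb F=\mathbb R$ and $j\ge 1$, then $\iota$ induces an isomorphism $$\pi_j(GL_o(A_\zeta))\xrightarrow{\ \cong\ }\pi_j(GL_o(A_{\zeta^+})),$$ natural in the same sense. -/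

import Mathlib

open Topology

noncomputable section

namespace SectionGL

/-! ### Homotopy groups of topological groups -/

section Homotopy

variable {H K : Type*} [Group H] [TopologicalSpace H] [IsTopologicalGroup H]
  [Group K] [TopologicalSpace K] [IsTopologicalGroup K]

theorem joined_mul {a b c d : H} (h₁ : Joined a b) (h₂ : Joined c d) : Joined (a * c) (b * d) :=
  ⟨h₁.somePath.mul h₂.somePath⟩

theorem joined_map {S T : Type*} [TopologicalSpace S] [TopologicalSpace T] {a b : S} {f : S → T}
    (hf : Continuous f) (h : Joined a b) :
    Joined (f a) (f b) :=
  ⟨h.somePath.map hf⟩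

/-- The group structure on the set `π₀ H` of path components of a topological group. -/
instance : Group (ZerothHomotopy H) where
  mul := Quotient.map₂ (· * ·) fun _ _ h₁ _ _ h₂ => joined_mul h₁ h₂
  one := ZerothHomotopy.mk 1
  inv := Quotient.map (·⁻¹) fun _ _ h => joined_map continuous_inv h
  mul_assoc := by
    rintro ⟨a⟩ ⟨b⟩ ⟨c⟩
    exact congrArg ZerothHomotopy.mk (mul_assoc a b c)
  one_mul := by
    rintro ⟨a⟩
    exact congrArg ZerothHomotopy.mk (one_mul a)
  mul_one := by
    rintro ⟨a⟩
    exact congrArg ZerothHomotopy.mk (mul_one a)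
  inv_mul_cancel := by
    rintro ⟨a⟩
    exact congrArg ZerothHomotopy.mk (inv_mul_cancel a)

/-- The homomorphism induced on `π₀`. -/
def pi0Hom (f : H →ₜ* K) : ZerothHomotopy H →* ZerothHomotopy K where
  toFun := Quotient.map f fun _ _ h => joined_map f.continuous_toFun h
  map_one' := congrArg ZerothHomotopy.mk (map_one f)
  map_mul' := by
    rintro ⟨a⟩ ⟨b⟩
    exact congrArg ZerothHomotopy.mk (map_mul f a b)

/-- The map on `n`-dimensional loops based at `1`. -/
def genLoopMap {N : Type*} (f : H →ₜ* K) (p : GenLoop N H 1) : GenLoop N K 1 :=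
  ⟨(f : C(H, K)).comp p.1, fun y hy => by
    have h : p.1 y = 1 := p.2 y hy
    simp [h]⟩

/-- The homomorphism induced on `π_{k+1}`, base points being the unit elements. -/
def piHom (k : ℕ) (f : H →ₜ* K) : π_ (k + 1) H 1 →* π_ (k + 1) K 1 where
  toFun := Quotient.map (genLoopMap f) fun _ _ h => h.map fun F =>
    F.compContinuousMap (f : C(H, K))
  map_one' := by
    refine congrArg (Quotient.mk _) ?_
    ext y
    exact map_one f
  map_mul' := by
    rintro ⟨a⟩ ⟨b⟩
    have h1 := HomotopyGroup.mul_spec (i := (0 : Fin (k + 1))) (p := a) (q := b)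
    have h2 := HomotopyGroup.mul_spec (i := (0 : Fin (k + 1)))
      (p := genLoopMap f a) (q := genLoopMap f b)
    refine (congrArg _ h1).trans (Eq.trans ?_ h2.symm)
    refine congrArg (Quotient.mk _) ?_
    ext y
    change f (GenLoop.transAt 0 b a y) = GenLoop.transAt 0 (genLoopMap f b) (genLoopMap f a) y
    simp only [GenLoop.transAt, GenLoop.coe_copy]
    split_ifs <;> rfl

variable (H) in
/-- The path component of the identity. -/
def idComponent : Subgroup H where
  carrier := pathComponent 1
  one_mem' := mem_pathComponent_self 1
  mul_mem' := fun {a b} ha hb => by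
    have := joined_mul (a := (1 : H)) (c := 1) ha hb
    rwa [mul_one] at this
  inv_mem' := fun {a} ha => by
    have := joined_map (a := (1 : H)) continuous_inv ha
    rwa [inv_one] at this

/-- The restriction of a continuous homomorphism to identity components. -/
def idComponentMap (f : H →ₜ* K) : idComponent H →ₜ* idComponent K where
  toFun x := ⟨f x, by
    have := joined_map (a := (1 : H)) f.continuous_toFun x.2
    have h1 : f.toFun 1 = 1 := map_one f
    rwa [h1] at this⟩
  map_one' := Subtype.ext (map_one f)
  map_mul' x y := Subtype.ext (map_mul f x.1 y.1)
  continuous_toFun := by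
    exact (f.continuous_toFun.comp continuous_subtype_val).subtype_mk _

end Homotopy

/-- `1 → A → B → C → 1` is exact and `s` is a homomorphism splitting `q`. -/
structure IsSplitShortExact {A B C : Type*} [Group A] [Group B] [Group C]
    (i : A →* B) (q : B →* C) (s : C →* B) : Prop where
  injective : Function.Injective i
  exact : i.range = q.ker
  surjective : Function.Surjective q
  splits : q.comp s = MonoidHom.id C

/-! ### Čech cohomology with constant coefficients -/

section Cech

/-- An open cover of `X` indexed by the points of `X`, the point `x` lying in the `x`-th set.
Every open cover is refined by such a cover, and between two such covers there is a canonical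
refinement map, so these covers compute the Čech direct limit over all open covers. -/
structure PtCover (X : Type*) [TopologicalSpace X] where
  set : X → Set X
  isOpen : ∀ x, IsOpen (set x)
  mem : ∀ x, x ∈ set x

variable {X Y Z : Type*} [TopologicalSpace X] [TopologicalSpace Y] [TopologicalSpace Z]

/-- `U ≤ V` means that `V` is finer than `U`. -/
instance : Preorder (PtCover X) where
  le U V := ∀ x, V.set x ⊆ U.set x
  le_refl _ _ := subset_rfl
  le_trans _ _ _ h₁ h₂ x := (h₂ x).trans (h₁ x)

/-- Ordered `p`-simplices of the nerve of `U`. -/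
def Simplex (U : PtCover X) (p : ℕ) : Type _ :=
  {σ : Fin (p + 1) → X // (⋂ i, U.set (σ i)).Nonempty}

def Simplex.face {U : PtCover X} {p : ℕ} (σ : Simplex U (p + 1)) (i : Fin (p + 2)) :
    Simplex U p :=
  ⟨fun j => σ.1 (i.succAbove j), σ.2.mono fun _ hx =>
    Set.mem_iInter.2 fun j => Set.mem_iInter.1 hx (i.succAbove j)⟩

/-- `p`-cochains of the nerve of `U` with coefficients in `M`. -/
abbrev Cochain (U : PtCover X) (p : ℕ) (M : Type*) : Type _ := Simplex U p → M

variable {M : Type*} [AddCommGroup M]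

def coboundary (U : PtCover X) (p : ℕ) (M : Type*) [AddCommGroup M] :
    Cochain U p M →+ Cochain U (p + 1) M where
  toFun c σ := ∑ i : Fin (p + 2), (-1 : ℤ) ^ (i : ℕ) • c (σ.face i)
  map_zero' := by ext; simp
  map_add' a b := by ext; simp [Finset.sum_add_distrib]

/-- The group of `p`-coboundaries (zero for `p = 0`). -/
def boundaries (U : PtCover X) : (p : ℕ) → (M : Type*) → [AddCommGroup M] →
    AddSubgroup (Cochain U p M)
  | 0, _, _ => ⊥
  | p + 1, M, _ => (coboundary U p M).range

abbrev cocycles (U : PtCover X) (p : ℕ) (M : Type*) [AddCommGroup M] :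
    AddSubgroup (Cochain U p M) :=
  (coboundary U p M).ker

/-- The `p`-th cohomology of the nerve of `U`. -/
abbrev NerveCohomology (U : PtCover X) (p : ℕ) (M : Type*) [AddCommGroup M] : Type _ :=
  cocycles U p M ⧸ (boundaries U p M).addSubgroupOf (cocycles U p M)

/-- `f` maps the cover `V` of `Y` into the cover `U` of `X`. -/
def Subordinate (f : Y → X) (V : PtCover Y) (U : PtCover X) : Prop :=
  ∀ y, V.set y ⊆ f ⁻¹' U.set (f y)

def Simplex.map {V : PtCover Y} {U : PtCover X} (f : Y → X) (h : Subordinate f V U) {p : ℕ}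
    (σ : Simplex V p) : Simplex U p :=
  ⟨fun j => f (σ.1 j), by
    obtain ⟨y, hy⟩ := σ.2
    exact ⟨f y, Set.mem_iInter.2 fun j => h _ (Set.mem_iInter.1 hy j)⟩⟩

def cochainMap {V : PtCover Y} {U : PtCover X} (f : Y → X) (h : Subordinate f V U) (p : ℕ)
    (M : Type*) [AddCommGroup M] : Cochain U p M →+ Cochain V p M where
  toFun c σ := c (σ.map f h)
  map_zero' := rfl
  map_add' _ _ := rfl

theorem cochainMap_coboundary {V : PtCover Y} {U : PtCover X} (f : Y → X)
    (h : Subordinate f V U) (p : ℕ) (c : Cochain U p M) :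
    coboundary V p M (cochainMap f h p M c) = cochainMap f h (p + 1) M (coboundary U p M c) :=
  rfl

theorem cochainMap_boundaries {V : PtCover Y} {U : PtCover X} (f : Y → X)
    (h : Subordinate f V U) (p : ℕ) (c : Cochain U p M) (hc : c ∈ boundaries U p M) :
    cochainMap f h p M c ∈ boundaries V p M := by
  cases p with
  | zero =>
    have h0 : c = 0 := hc
    subst h0
    exact (boundaries V 0 M).zero_mem
  | succ p =>
    obtain ⟨b, rfl⟩ := hc
    exact ⟨cochainMap f h p M b, rfl⟩

def cocycleMap {V : PtCover Y} {U : PtCover X} (f : Y → X) (h : Subordinate f V U) (p : ℕ)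
    (M : Type*) [AddCommGroup M] : cocycles U p M →+ cocycles V p M :=
  ((cochainMap f h p M).comp (cocycles U p M).subtype).codRestrict _ fun c => by
    have hc : coboundary U p M c.1 = 0 := c.2
    change coboundary V p M (cochainMap f h p M c.1) = 0
    rw [cochainMap_coboundary, hc, map_zero]

/-- The map on nerve cohomology induced by `f`; for `f = id` this is the refinement map. -/
def nerveMap {V : PtCover Y} {U : PtCover X} (f : Y → X) (h : Subordinate f V U) (p : ℕ)
    (M : Type*) [AddCommGroup M] : NerveCohomology U p M →+ NerveCohomology V p M :=
  QuotientAddGroup.map _ _ (cocycleMap f h p M) fun c hc =>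
    cochainMap_boundaries f h p c.1 hc

open Classical in
/-- Čech cohomology `Ȟ^p(X; M)`: the direct limit over open covers, ordered by refinement, of the
cohomology of the nerves. -/
def Cech (X : Type*) [TopologicalSpace X] (p : ℕ) (M : Type*) [AddCommGroup M] : Type _ :=
  AddCommGroup.DirectLimit (fun U : PtCover X => NerveCohomology U p M)
    fun _ _ h => nerveMap id h p M

open Classical in
instance (p : ℕ) : AddCommGroup (Cech X p M) :=
  inferInstanceAs (AddCommGroup (AddCommGroup.DirectLimit
    (fun U : PtCover X => NerveCohomology U p M) fun _ _ h => nerveMap id h p M))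

/-- The inverse image of a cover. -/
def PtCover.pullback (f : C(Y, X)) (U : PtCover X) : PtCover Y where
  set y := f ⁻¹' U.set (f y)
  isOpen y := (U.isOpen (f y)).preimage f.continuous
  mem y := U.mem (f y)

open Classical in
/-- The homomorphism `f^* : Ȟ^p(X; M) → Ȟ^p(Y; M)` induced by `f : Y → X`. -/
def cechMap (f : C(Y, X)) (p : ℕ) (M : Type*) [AddCommGroup M] : Cech X p M →+ Cech Y p M :=
  AddCommGroup.DirectLimit.lift _ _ _
    (fun U => (AddCommGroup.DirectLimit.of
      (fun U : PtCover Y => NerveCohomology U p M) (fun _ _ h => nerveMap id h p M)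
        (U.pullback f)).comp (nerveMap f (fun _ => subset_rfl) p M))
    fun U V hUV x => by
      have hle : U.pullback f ≤ V.pullback f := fun y => Set.preimage_mono (hUV (f y))
      obtain ⟨c, rfl⟩ := QuotientAddGroup.mk_surjective x
      exact AddCommGroup.DirectLimit.of_f (G := fun U : PtCover Y => NerveCohomology U p M)
        (f := fun _ _ h => nerveMap id h p M) hle
        (nerveMap f (fun _ => subset_rfl) p M (QuotientAddGroup.mk c))

end Cech

/-! ### Principal bundles and associated bundles -/

/-- A principal `G`-bundle over `X` with total space `P`: locally over `X` it is equivariantly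
isomorphic to `U × G`. The action of `G` on `P` is written on the left; the customary right action
is `p · g = g⁻¹ • p`. -/
structure PrincipalBundle (G P X : Type*) [Group G] [TopologicalSpace G] [TopologicalSpace P]
    [TopologicalSpace X] [MulAction G P] where
  proj : P → X
  continuous_proj : Continuous proj
  proj_smul : ∀ (g : G) (p : P), proj (g • p) = proj p
  exists_trivialization : ∀ x : X, ∃ e : Bundle.Trivialization G proj, x ∈ e.baseSet ∧
    ∀ (g : G) (p : P), proj p ∈ e.baseSet → (e (g • p)).2 = g * (e p).2

section Bundle

variable {G P X : Type*} [Group G] [TopologicalSpace G] [TopologicalSpace P] [TopologicalSpace X]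
  [MulAction G P]

namespace PrincipalBundle

variable (ζ : PrincipalBundle G P X)

theorem exists_localSection (x : X) : ∃ (U : Set X) (s : X → P), IsOpen U ∧ x ∈ U ∧
    ContinuousOn s U ∧ ∀ y ∈ U, ζ.proj (s y) = y := by
  obtain ⟨e, hx, -⟩ := ζ.exists_trivialization x
  refine ⟨e.baseSet, fun y => e.toOpenPartialHomeomorph.symm (y, 1), e.open_baseSet, hx, ?_, ?_⟩
  · refine e.toOpenPartialHomeomorph.continuousOn_symm.comp (by fun_prop) fun y hy => ?_
    rw [e.target_eq]
    exact ⟨hy, trivial⟩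
  · intro y hy
    exact e.proj_symm_apply' hy

theorem proj_surjective : Function.Surjective ζ.proj := fun x => by
  obtain ⟨U, s, -, hx, -, h⟩ := ζ.exists_localSection x
  exact ⟨s x, h x hx⟩

/-- A point of `P` over `x`. -/
def point (x : X) : P := (ζ.proj_surjective x).choose

theorem proj_point (x : X) : ζ.proj (ζ.point x) = x := (ζ.proj_surjective x).choose_spec

theorem exists_smul_eq {p p' : P} (h : ζ.proj p = ζ.proj p') : ∃ g : G, g • p' = p := by
  obtain ⟨e, hx, he⟩ := ζ.exists_trivialization (ζ.proj p')
  refine ⟨(e p).2 * (e p').2⁻¹, ?_⟩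
  have hs : (((e p).2 * (e p').2⁻¹) • p') ∈ e.source := by
    rw [e.mem_source, ζ.proj_smul]; exact hx
  have hp : p ∈ e.source := by rw [e.mem_source, h]; exact hx
  refine e.injOn hs hp (Prod.ext ?_ ?_)
  · change (e _).1 = (e _).1
    rw [e.coe_fst hs, e.coe_fst hp, ζ.proj_smul, h]
  · change (e _).2 = (e _).2
    rw [he _ _ hx]; group

theorem smul_free (ζ : PrincipalBundle G P X) {g : G} {p : P} (h : g • p = p) : g = 1 := by
  obtain ⟨e, hx, he⟩ := ζ.exists_trivialization (ζ.proj p)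
  have := he g p hx
  rw [h] at this
  simpa using this

/-- The element of `G` carrying `p'` to `p`, for two points of one fibre. -/
def translation (q : {q : P × P // ζ.proj q.1 = ζ.proj q.2}) : G :=
  (ζ.exists_smul_eq q.2).choose

theorem translation_smul (q : {q : P × P // ζ.proj q.1 = ζ.proj q.2}) :
    ζ.translation q • q.1.2 = q.1.1 := (ζ.exists_smul_eq q.2).choose_spec

theorem continuous_translation [IsTopologicalGroup G] : Continuous ζ.translation := by
  rw [continuous_iff_continuousAt]
  intro q₀
  obtain ⟨e, hx, he⟩ := ζ.exists_trivialization (ζ.proj q₀.1.2)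
  have hs : ∀ p, p ∈ e.source ↔ ζ.proj p ∈ e.baseSet := fun p => e.mem_source
  have key : ∀ᶠ q in 𝓝 q₀, (e q.1.1).2 * (e q.1.2).2⁻¹ = ζ.translation q := by
    have hU : IsOpen {q : {q : P × P // ζ.proj q.1 = ζ.proj q.2} | ζ.proj q.1.2 ∈ e.baseSet} :=
      e.open_baseSet.preimage
        (ζ.continuous_proj.comp (continuous_snd.comp continuous_subtype_val))
    filter_upwards [hU.mem_nhds hx] with q hq
    have h1 := he (ζ.translation q) q.1.2 hq
    rw [ζ.translation_smul] at h1
    rw [h1]; group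
  refine ContinuousAt.congr ?_ key
  have c1 : ContinuousAt (fun q : {q : P × P // ζ.proj q.1 = ζ.proj q.2} => e q.1.1) q₀ :=
    ContinuousAt.comp (f := fun q : {q : P × P // ζ.proj q.1 = ζ.proj q.2} => q.1.1)
      (e.continuousAt ((hs _).2 (by rw [q₀.2]; exact hx)))
      (continuous_fst.comp continuous_subtype_val).continuousAt
  have c2 : ContinuousAt (fun q : {q : P × P // ζ.proj q.1 = ζ.proj q.2} => e q.1.2) q₀ :=
    ContinuousAt.comp (f := fun q : {q : P × P // ζ.proj q.1 = ζ.proj q.2} => q.1.2)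
      (e.continuousAt ((hs _).2 hx))
      (continuous_snd.comp continuous_subtype_val).continuousAt
  exact c1.snd.mul c2.snd.inv

/-- The map on `X` induced by a map on `P` that is constant on the fibres. -/
def descend {Z : Type*} (k : P → Z) (x : X) : Z := k (ζ.point x)

theorem descend_proj {Z : Type*} {k : P → Z} (hk : ∀ (g : G) p, k (g • p) = k p) (p : P) :
    ζ.descend k (ζ.proj p) = k p := by
  obtain ⟨g, hg⟩ := ζ.exists_smul_eq (ζ.proj_point (ζ.proj p))
  rw [descend, ← hg, hk]

theorem continuous_descend {T Z : Type*} [TopologicalSpace T] [TopologicalSpace Z]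
    {k : T → P → Z} (hc : Continuous fun q : T × P => k q.1 q.2)
    (hk : ∀ t (g : G) p, k t (g • p) = k t p) :
    Continuous fun q : T × X => ζ.descend (k q.1) q.2 := by
  rw [continuous_iff_continuousAt]
  rintro ⟨t, x⟩
  obtain ⟨U, s, hU, hx, hs, h⟩ := ζ.exists_localSection x
  have hs' : ContinuousAt (fun q : T × X => s q.2) (t, x) :=
    ContinuousAt.comp (f := Prod.snd) (hs.continuousAt (hU.mem_nhds hx)) continuous_snd.continuousAt
  have h1 : ContinuousAt (fun q : T × X => k q.1 (s q.2)) (t, x) :=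
    ContinuousAt.comp (f := fun q : T × X => (q.1, s q.2)) (g := fun q : T × P => k q.1 q.2)
      hc.continuousAt (continuous_fst.continuousAt.prodMk hs')
  refine h1.congr ?_
  filter_upwards [(hU.preimage continuous_snd).mem_nhds (x := ((t, x) : T × X)) hx] with q hq
  conv_rhs => rw [← h q.2 hq]
  exact (ζ.descend_proj (hk q.1) _).symm

end PrincipalBundle

variable (ζ : PrincipalBundle G P X) (F : Type*) [TopologicalSpace F] [MulAction G F]

/-- The total space of the associated bundle `P ×_G F`: the quotient of `P × F` by the diagonal
action of `G`. -/
def Assoc (_ζ : PrincipalBundle G P X) (F : Type*) [TopologicalSpace F] [MulAction G F] : Type _ :=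
  MulAction.orbitRel.Quotient G (P × F)

instance : TopologicalSpace (Assoc ζ F) :=
  inferInstanceAs (TopologicalSpace (Quotient (MulAction.orbitRel G (P × F))))

variable {F}

namespace Assoc

def mk (p : P) (b : F) : Assoc ζ F := Quotient.mk (MulAction.orbitRel G (P × F)) (p, b)

theorem mk_smul (g : G) (p : P) (b : F) : mk ζ (g • p) (g • b) = mk ζ p b :=
  Quotient.sound ⟨g, rfl⟩

theorem continuous_mk : Continuous fun q : P × F => mk ζ q.1 q.2 := continuous_quotient_mk'

/-- The bundle projection `P ×_G F → X`. -/
def proj : Assoc ζ F → X :=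
  Quotient.lift (fun q : P × F => ζ.proj q.1) (by
    rintro _ b ⟨g, rfl⟩
    exact ζ.proj_smul g b.1)

@[simp]
theorem proj_mk (p : P) (b : F) : proj ζ (mk ζ p b) = ζ.proj p := rfl

theorem mk_injective (p : P) : Function.Injective (mk ζ p : F → Assoc ζ F) := by
  intro b b' h
  obtain ⟨g, hg⟩ := Quotient.exact h
  have h1 : g • p = p := congrArg Prod.fst hg
  have h2 : g • b' = b := congrArg Prod.snd hg
  rw [← h2, ζ.smul_free h1, one_smul]

theorem exists_mk_eq {p : P} {e : Assoc ζ F} (h : ζ.proj p = proj ζ e) : ∃ b, mk ζ p b = e := by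
  obtain ⟨⟨p', b⟩, rfl⟩ := Quotient.exists_rep e
  obtain ⟨g, hg⟩ := ζ.exists_smul_eq (p := p) (p' := p') h
  refine ⟨g • b, ?_⟩
  rw [← hg]
  exact mk_smul ζ g p' b

/-- The identification of the fibre over `ζ.proj p` with `F` given by `p`. -/
def coord (q : {q : P × Assoc ζ F // ζ.proj q.1 = proj ζ q.2}) : F :=
  (exists_mk_eq ζ q.2).choose

theorem mk_coord (q : {q : P × Assoc ζ F // ζ.proj q.1 = proj ζ q.2}) :
    mk ζ q.1.1 (coord ζ q) = q.1.2 := (exists_mk_eq ζ q.2).choose_spec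

theorem continuous_coord [IsTopologicalGroup G] [ContinuousSMul G P] [ContinuousSMul G F] :
    Continuous (coord ζ (F := F)) := by
  let S : Set (P × Assoc ζ F) := {q | ζ.proj q.1 = proj ζ q.2}
  let m : P × (P × F) → P × Assoc ζ F := Prod.map id (Quotient.mk _)
  have hm : IsOpenQuotientMap m :=
    IsOpenQuotientMap.id.prodMap (MulAction.isOpenQuotientMap_quotientMk (Γ := G) (T := P × F))
  have hq : IsQuotientMap (S.restrictPreimage m) :=
    (hm.isOpenMap.restrictPreimage S).isQuotientMap (hm.continuous.restrictPreimage)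
      (hm.surjective.restrictPreimage S)
  refine hq.continuous_iff.2 ?_
  have : coord ζ ∘ S.restrictPreimage m =
      fun q => ζ.translation ⟨(q.1.1, q.1.2.1), q.2⟩ • q.1.2.2 := by
    funext q
    apply mk_injective ζ q.1.1
    refine (mk_coord ζ (S.restrictPreimage m q)).trans ?_
    have h := ζ.translation_smul ⟨(q.1.1, q.1.2.1), q.2⟩
    refine ((mk_smul ζ (ζ.translation ⟨(q.1.1, q.1.2.1), q.2⟩) q.1.2.1 q.1.2.2).symm).trans ?_
    exact congrArg (fun p => mk ζ p _) h
  rw [this]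
  refine (ζ.continuous_translation.comp ?_).smul ?_ <;> fun_prop

end Assoc

variable (F)

/-- Continuous sections of `P ×_G F`, with the compact-open topology. (For compact `X` and a Banach
algebra `F` this is the topology of uniform convergence, that is, the Banach algebra topology.) -/
def Sec : Type _ := {s : C(X, Assoc ζ F) // ∀ x, Assoc.proj ζ (s x) = x}

instance : TopologicalSpace (Sec ζ F) := inferInstanceAs (TopologicalSpace (Subtype _))

variable {F}

namespace Sec

variable {ζ}

/-- The value of the section `s` over `ζ.proj p`, read in `F` through `p`. -/
def coords (s : Sec ζ F) (p : P) : F :=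
  Assoc.coord ζ ⟨(p, s.1 (ζ.proj p)), (s.2 _).symm⟩

theorem mk_coords (s : Sec ζ F) (p : P) : Assoc.mk ζ p (s.coords p) = s.1 (ζ.proj p) :=
  Assoc.mk_coord ζ ⟨(p, s.1 (ζ.proj p)), (s.2 _).symm⟩

theorem coords_smul (s : Sec ζ F) (g : G) (p : P) : s.coords (g • p) = g • s.coords p := by
  apply Assoc.mk_injective ζ (g • p)
  rw [mk_coords, Assoc.mk_smul, mk_coords, ζ.proj_smul]

theorem coords_injective : Function.Injective (coords : Sec ζ F → P → F) := by
  intro s t h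
  refine Subtype.ext (ContinuousMap.ext fun x => ?_)
  obtain ⟨p, rfl⟩ := ζ.proj_surjective x
  rw [← mk_coords, ← mk_coords, h]

theorem continuous_coords [IsTopologicalGroup G] [ContinuousSMul G P] [ContinuousSMul G F]
    [LocallyCompactSpace X] : Continuous fun q : Sec ζ F × P => q.1.coords q.2 := by
  refine (Assoc.continuous_coord ζ).comp (Continuous.subtype_mk (continuous_snd.prodMk ?_) _)
  exact (continuous_eval (F := C(X, Assoc ζ F))).comp
    ((continuous_subtype_val.comp continuous_fst).prodMk (ζ.continuous_proj.comp continuous_snd))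

theorem continuous_coords_apply [IsTopologicalGroup G] [ContinuousSMul G P] [ContinuousSMul G F]
    (s : Sec ζ F) : Continuous s.coords :=
  (Assoc.continuous_coord ζ).comp (Continuous.subtype_mk
    (continuous_id.prodMk (s.1.continuous.comp ζ.continuous_proj)) _)

/-- The section `x ↦ [p, h p]` (`p` any point over `x`) given by an equivariant map `h`. -/
def ofEquivariant (h : P → F) (hc : Continuous h) (hg : ∀ (g : G) p, h (g • p) = g • h p) :
    Sec ζ F :=
  ⟨⟨ζ.descend fun p => Assoc.mk ζ p (h p), by
    have := ζ.continuous_descend (T := Unit) (k := fun _ p => Assoc.mk ζ p (h p))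
      ((Assoc.continuous_mk ζ).comp (continuous_snd.prodMk (hc.comp continuous_snd)))
      (fun _ g p => by rw [hg, Assoc.mk_smul])
    exact this.comp (continuous_const (y := ()).prodMk continuous_id)⟩, fun x => by
    change Assoc.proj ζ (Assoc.mk ζ _ _) = x
    rw [Assoc.proj_mk, ζ.proj_point]⟩

@[simp]
theorem coords_ofEquivariant (h : P → F) (hc : Continuous h)
    (hg : ∀ (g : G) p, h (g • p) = g • h p) : (ofEquivariant (ζ := ζ) h hc hg).coords = h := by
  funext p
  apply Assoc.mk_injective ζ p
  rw [mk_coords]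
  exact ζ.descend_proj (k := fun p => Assoc.mk ζ p (h p))
    (fun g p => by rw [hg, Assoc.mk_smul]) p

theorem continuous_ofEquivariant {T : Type*} [TopologicalSpace T] {h : T → P → F}
    (hj : Continuous fun q : T × P => h q.1 q.2) (hc : ∀ t, Continuous (h t))
    (hg : ∀ t (g : G) p, h t (g • p) = g • h t p) :
    Continuous fun t => ofEquivariant (ζ := ζ) (h t) (hc t) (hg t) := by
  refine Continuous.subtype_mk (ContinuousMap.continuous_of_continuous_uncurry _ ?_) _
  exact ζ.continuous_descend (k := fun t p => Assoc.mk ζ p (h t p))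
    ((Assoc.continuous_mk ζ).comp (continuous_snd.prodMk hj))
    (fun t g p => by rw [hg, Assoc.mk_smul])

end Sec

/-- `G` acts on the algebra `F` by multiplicative maps. -/
class MulAct (G F : Type*) [Group G] [NonUnitalRing F] [DistribMulAction G F] : Prop where
  smul_mul' : ∀ (g : G) (a b : F), g • (a * b) = g • a * g • b

instance {G F : Type*} [Group G] [Ring F] [MulSemiringAction G F] : MulAct G F :=
  ⟨MulSemiringAction.smul_mul⟩

/-! ### The algebra of sections -/

namespace Sec

section Algebra

variable {ζ : PrincipalBundle G P X} [IsTopologicalGroup G] [ContinuousSMul G P]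
  {F : Type*} [NonUnitalRing F] [TopologicalSpace F] [IsTopologicalRing F]
  [DistribMulAction G F] [ContinuousSMul G F]

instance : Zero (Sec ζ F) := ⟨ofEquivariant (fun _ => 0) continuous_const fun _ _ => by simp⟩

instance : Add (Sec ζ F) := ⟨fun s t => ofEquivariant (fun p => s.coords p + t.coords p)
  (s.continuous_coords_apply.add t.continuous_coords_apply)
  fun _ _ => by simp [coords_smul]⟩

instance : Neg (Sec ζ F) := ⟨fun s => ofEquivariant (fun p => -s.coords p)
  s.continuous_coords_apply.neg fun _ _ => by simp [coords_smul]⟩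

instance : Sub (Sec ζ F) := ⟨fun s t => ofEquivariant (fun p => s.coords p - t.coords p)
  (s.continuous_coords_apply.sub t.continuous_coords_apply)
  fun _ _ => by simp [coords_smul, smul_sub]⟩

instance [MulAct G F] : Mul (Sec ζ F) := ⟨fun s t =>
  ofEquivariant (fun p => s.coords p * t.coords p)
    (s.continuous_coords_apply.mul t.continuous_coords_apply)
    fun _ _ => by simp [coords_smul, MulAct.smul_mul']⟩

instance {R : Type*} [SMul R F] [SMulCommClass G R F] [ContinuousConstSMul R F] :
    SMul R (Sec ζ F) := ⟨fun r s => ofEquivariant (fun p => r • s.coords p)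
  (s.continuous_coords_apply.const_smul r) fun _ _ => by simp [coords_smul, smul_comm]⟩

theorem coords_zero : coords (0 : Sec ζ F) = 0 := coords_ofEquivariant _ _ _

theorem coords_add (s t : Sec ζ F) : coords (s + t) = coords s + coords t :=
  coords_ofEquivariant _ _ _

theorem coords_neg (s : Sec ζ F) : coords (-s) = -coords s := coords_ofEquivariant _ _ _

theorem coords_sub (s t : Sec ζ F) : coords (s - t) = coords s - coords t :=
  coords_ofEquivariant _ _ _

theorem coords_mul [MulAct G F] (s t : Sec ζ F) : coords (s * t) = coords s * coords t :=
  coords_ofEquivariant _ _ _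

theorem coords_rsmul {R : Type*} [SMul R F] [SMulCommClass G R F] [ContinuousConstSMul R F]
    (r : R) (s : Sec ζ F) : coords (r • s) = r • coords s := coords_ofEquivariant _ _ _

/-- Addition and multiplication of sections are fibrewise. -/
instance [MulAct G F] : NonUnitalRing (Sec ζ F) :=
  coords_injective.nonUnitalRing coords coords_zero coords_add coords_mul coords_neg coords_sub
    (fun _ _ => coords_rsmul _ _) (fun _ _ => coords_rsmul _ _)

variable {𝕜 : Type*} [CommRing 𝕜] [Module 𝕜 F] [SMulCommClass G 𝕜 F] [ContinuousConstSMul 𝕜 F]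
  [MulAct G F]

instance : Module 𝕜 (Sec ζ F) :=
  coords_injective.module 𝕜 (⟨⟨coords, coords_zero⟩, coords_add⟩ : Sec ζ F →+ (P → F))
    fun r s => coords_rsmul r s

instance [IsScalarTower 𝕜 F F] : IsScalarTower 𝕜 (Sec ζ F) (Sec ζ F) :=
  ⟨fun r s t => coords_injective (by
    simp only [smul_eq_mul, coords_mul, coords_rsmul, smul_mul_assoc])⟩

instance [SMulCommClass 𝕜 F F] : SMulCommClass 𝕜 (Sec ζ F) (Sec ζ F) :=
  ⟨fun r s t => coords_injective (by
    simp only [smul_eq_mul, coords_mul, coords_rsmul, mul_smul_comm])⟩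

variable [LocallyCompactSpace X]

instance : ContinuousAdd (Sec ζ F) := ⟨by
  refine continuous_ofEquivariant (T := Sec ζ F × Sec ζ F)
    (h := fun q p => q.1.coords p + q.2.coords p) ?_ _ _
  exact (continuous_coords.comp ((continuous_fst.comp continuous_fst).prodMk continuous_snd)).add
    (continuous_coords.comp ((continuous_snd.comp continuous_fst).prodMk continuous_snd))⟩

instance : ContinuousNeg (Sec ζ F) := ⟨by
  refine continuous_ofEquivariant (T := Sec ζ F) (h := fun q p => -q.coords p) ?_ _ _
  exact continuous_coords.neg⟩

instance : ContinuousMul (Sec ζ F) := ⟨by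
  refine continuous_ofEquivariant (T := Sec ζ F × Sec ζ F)
    (h := fun q p => q.1.coords p * q.2.coords p) ?_ _ _
  exact (continuous_coords.comp ((continuous_fst.comp continuous_fst).prodMk continuous_snd)).mul
    (continuous_coords.comp ((continuous_snd.comp continuous_fst).prodMk continuous_snd))⟩

instance : IsTopologicalRing (Sec ζ F) where

instance [TopologicalSpace 𝕜] [ContinuousSMul 𝕜 F] : ContinuousSMul 𝕜 (Sec ζ F) := ⟨by
  refine continuous_ofEquivariant (T := 𝕜 × Sec ζ F)
    (h := fun q p => q.1 • q.2.coords p) ?_ _ _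
  exact (continuous_fst.comp continuous_fst).smul
    (continuous_coords.comp ((continuous_snd.comp continuous_fst).prodMk continuous_snd))⟩

end Algebra

section Unital

variable {ζ : PrincipalBundle G P X} [IsTopologicalGroup G] [ContinuousSMul G P]
  {F : Type*} [Ring F] [TopologicalSpace F] [IsTopologicalRing F]
  [MulSemiringAction G F] [ContinuousSMul G F]

instance : One (Sec ζ F) := ⟨ofEquivariant (fun _ => 1) continuous_const fun _ _ => by simp⟩

theorem coords_one : coords (1 : Sec ζ F) = 1 := coords_ofEquivariant _ _ _

instance : Ring (Sec ζ F) where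
  __ := (inferInstance : NonUnitalRing (Sec ζ F))
  one_mul s := coords_injective (by rw [coords_mul, coords_one, one_mul])
  mul_one s := coords_injective (by rw [coords_mul, coords_one, mul_one])

instance {𝕜 : Type*} [CommRing 𝕜] [Algebra 𝕜 F] [SMulCommClass G 𝕜 F]
    [ContinuousConstSMul 𝕜 F] : Algebra 𝕜 (Sec ζ F) :=
  Algebra.ofModule smul_mul_assoc mul_smul_comm

end Unital

end Sec

end Bundle

/-! ### Unitization and general linear groups -/

section Plus

/-- The unitization `A⁺ = 𝕜 ⊕ A`, with the product topology. -/
def Plus (𝕜 A : Type*) : Type _ := Unitization 𝕜 A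

namespace Plus

variable {𝕜 A : Type*} [CommRing 𝕜] [NonUnitalRing A]
  [Module 𝕜 A] [IsScalarTower 𝕜 A A] [SMulCommClass 𝕜 A A]

instance : Ring (Plus 𝕜 A) := inferInstanceAs (Ring (Unitization 𝕜 A))

instance : Algebra 𝕜 (Plus 𝕜 A) := inferInstanceAs (Algebra 𝕜 (Unitization 𝕜 A))

def mk {𝕜 A : Type*} (r : 𝕜) (a : A) : Plus 𝕜 A := Unitization.mk (r, a)

def fst {𝕜 A : Type*} (x : Plus 𝕜 A) : 𝕜 := Unitization.toProd x |>.1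

def snd {𝕜 A : Type*} (x : Plus 𝕜 A) : A := Unitization.toProd x |>.2

theorem ext {𝕜 A : Type*} {x y : Plus 𝕜 A} (h₁ : fst x = fst y) (h₂ : snd x = snd y) : x = y :=
  Unitization.toProd_injective (Prod.ext h₁ h₂)

section

variable (x y : Plus 𝕜 A) (r : 𝕜)

theorem fst_one : fst (1 : Plus 𝕜 A) = 1 := rfl
theorem fst_mul : fst (x * y) = fst x * fst y := rfl
theorem fst_add : fst (x + y) = fst x + fst y := rfl
theorem snd_mul : snd (x * y) = fst x • snd y + fst y • snd x + snd x * snd y := rfl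

end

instance {𝕜 A : Type*} [TopologicalSpace 𝕜] [TopologicalSpace A] :
    TopologicalSpace (Plus 𝕜 A) :=
  TopologicalSpace.induced (fun x => (fst x, snd x)) inferInstance

section Topology

variable [TopologicalSpace 𝕜] [TopologicalSpace A]

theorem continuous_pair {𝕜 A : Type*} [TopologicalSpace 𝕜] [TopologicalSpace A] :
    Continuous fun x : Plus 𝕜 A => (fst x, snd x) := continuous_induced_dom

theorem continuous_fst {𝕜 A : Type*} [TopologicalSpace 𝕜] [TopologicalSpace A] :
    Continuous (fst : Plus 𝕜 A → 𝕜) := _root_.continuous_fst.comp continuous_pair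

theorem continuous_snd {𝕜 A : Type*} [TopologicalSpace 𝕜] [TopologicalSpace A] :
    Continuous (snd : Plus 𝕜 A → A) := _root_.continuous_snd.comp continuous_pair

theorem continuous_rng {𝕜 A : Type*} [TopologicalSpace 𝕜] [TopologicalSpace A] {T : Type*}
    [TopologicalSpace T] {f : T → Plus 𝕜 A} (h₁ : Continuous fun t => fst (f t))
    (h₂ : Continuous fun t => snd (f t)) : Continuous f :=
  continuous_induced_rng.2 (h₁.prodMk h₂)

variable [IsTopologicalRing 𝕜] [IsTopologicalRing A] [ContinuousSMul 𝕜 A]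

instance : IsTopologicalRing (Plus 𝕜 A) where
  continuous_add := continuous_rng
    ((continuous_fst.comp _root_.continuous_fst).add (continuous_fst.comp _root_.continuous_snd))
    ((continuous_snd.comp _root_.continuous_fst).add (continuous_snd.comp _root_.continuous_snd))
  continuous_mul := by
    have f1 : Continuous fun q : Plus 𝕜 A × Plus 𝕜 A => fst q.1 :=
      continuous_fst.comp _root_.continuous_fst
    have f2 : Continuous fun q : Plus 𝕜 A × Plus 𝕜 A => fst q.2 :=
      continuous_fst.comp _root_.continuous_snd
    have s1 : Continuous fun q : Plus 𝕜 A × Plus 𝕜 A => snd q.1 :=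
      continuous_snd.comp _root_.continuous_fst
    have s2 : Continuous fun q : Plus 𝕜 A × Plus 𝕜 A => snd q.2 :=
      continuous_snd.comp _root_.continuous_snd
    exact continuous_rng (f1.mul f2) (((f1.smul s2).add (f2.smul s1)).add (s1.mul s2))
  continuous_neg := continuous_rng continuous_fst.neg continuous_snd.neg

instance : ContinuousSMul 𝕜 (Plus 𝕜 A) := ⟨continuous_rng
  (_root_.continuous_fst.mul (continuous_fst.comp _root_.continuous_snd))
  (_root_.continuous_fst.smul (continuous_snd.comp _root_.continuous_snd))⟩

end Topology

section Action

variable {G : Type*} [Group G] [DistribMulAction G A] [SMulCommClass G 𝕜 A] [MulAct G A]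

/-- The extension of a `G`-action to the unitization, fixing the scalars. -/
instance : MulSemiringAction G (Plus 𝕜 A) where
  smul g x := mk (fst x) (g • snd x)
  one_smul x := ext rfl (one_smul G (snd x))
  mul_smul g h x := ext rfl (mul_smul g h (snd x))
  smul_zero g := ext rfl (smul_zero g)
  smul_add g x y := ext rfl (smul_add g (snd x) (snd y))
  smul_one g := ext rfl (smul_zero g)
  smul_mul g x y := ext rfl (by
    change g • (fst x • snd y + fst y • snd x + snd x * snd y) =
      fst x • g • snd y + fst y • g • snd x + g • snd x * g • snd y
    rw [smul_add, smul_add, MulAct.smul_mul', smul_comm g, smul_comm g])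

theorem fst_smul (g : G) (x : Plus 𝕜 A) : fst (g • x) = fst x := rfl
theorem snd_smul (g : G) (x : Plus 𝕜 A) : snd (g • x) = g • snd x := rfl

instance : SMulCommClass G 𝕜 (Plus 𝕜 A) :=
  ⟨fun g r x => ext rfl (smul_comm g r (snd x))⟩

instance [TopologicalSpace 𝕜] [TopologicalSpace A] [TopologicalSpace G] [ContinuousSMul G A] :
    ContinuousSMul G (Plus 𝕜 A) := ⟨continuous_rng
  (show Continuous fun q : G × Plus 𝕜 A => fst q.2 from continuous_fst.comp _root_.continuous_snd)
  (_root_.continuous_fst.smul (continuous_snd.comp _root_.continuous_snd))⟩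

end Action

variable (𝕜 A) in
/-- The character `A⁺ → 𝕜`. -/
def fstHom : Plus 𝕜 A →ₐ[𝕜] 𝕜 := Unitization.fstHom 𝕜 A

variable (𝕜 A) in
/-- The inclusion `A → A⁺`. -/
def inrHom : A →ₙₐ[𝕜] Plus 𝕜 A := Unitization.inrNonUnitalAlgHom 𝕜 A

/-- The extension `r + a ↦ r · 1 + φ a` of `φ` to `A⁺`. -/
def lift {C : Type*} [Ring C] [Algebra 𝕜 C] (φ : A →ₙₐ[𝕜] C) : Plus 𝕜 A →ₐ[𝕜] C :=
  Unitization.lift φ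

theorem continuous_lift {C : Type*} [Ring C] [Algebra 𝕜 C] [TopologicalSpace 𝕜]
    [TopologicalSpace A] [TopologicalSpace C] [ContinuousAdd C] [ContinuousSMul 𝕜 C]
    (φ : A →ₙₐ[𝕜] C) (hφ : Continuous φ) : Continuous (lift φ) :=
  ((continuous_algebraMap 𝕜 C).comp continuous_fst).add (hφ.comp continuous_snd)

/-- The unital extension `A⁺ → A'⁺` of `φ : A → A'`. -/
def map {A' : Type*} [NonUnitalRing A'] [Module 𝕜 A'] [IsScalarTower 𝕜 A' A']
    [SMulCommClass 𝕜 A' A'] (φ : A →ₙₐ[𝕜] A') : Plus 𝕜 A →ₐ[𝕜] Plus 𝕜 A' :=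
  lift ((inrHom 𝕜 A').comp φ)

theorem fst_map {A' : Type*} [NonUnitalRing A'] [Module 𝕜 A'] [IsScalarTower 𝕜 A' A']
    [SMulCommClass 𝕜 A' A'] (φ : A →ₙₐ[𝕜] A') (x : Plus 𝕜 A) : fst (map φ x) = fst x :=
  add_zero (fst x)

theorem snd_map {A' : Type*} [NonUnitalRing A'] [Module 𝕜 A'] [IsScalarTower 𝕜 A' A']
    [SMulCommClass 𝕜 A' A'] (φ : A →ₙₐ[𝕜] A') (x : Plus 𝕜 A) : snd (map φ x) = φ (snd x) :=
  zero_add (φ (snd x))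

theorem continuous_map {A' : Type*} [NonUnitalRing A'] [Module 𝕜 A'] [IsScalarTower 𝕜 A' A']
    [SMulCommClass 𝕜 A' A'] [TopologicalSpace 𝕜] [TopologicalSpace A] [TopologicalSpace A']
    (φ : A →ₙₐ[𝕜] A') (hφ : Continuous φ) : Continuous (map φ) := by
  refine continuous_rng ?_ ?_
  · simp only [fst_map]; exact continuous_fst
  · simp only [snd_map]; exact hφ.comp continuous_snd

end Plus

variable (𝕜 : Type*) [CommRing 𝕜]

/-- `GL(A)` for a non-unital algebra `A`: the kernel of `GL(A⁺) → GL(A⁺/A) = GL(𝕜)`. -/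
abbrev GLnu (A : Type*) [NonUnitalRing A] [Module 𝕜 A] [IsScalarTower 𝕜 A A]
    [SMulCommClass 𝕜 A A] : Subgroup (Plus 𝕜 A)ˣ :=
  (Units.map (Plus.fstHom 𝕜 A : Plus 𝕜 A →* 𝕜)).ker

end Plus

/-! ### Maps of bundles and of section algebras -/

section Maps

variable {G P X P' X' : Type*} [Group G] [TopologicalSpace G] [IsTopologicalGroup G]
  [TopologicalSpace P] [TopologicalSpace X] [MulAction G P] [ContinuousSMul G P]
  [TopologicalSpace P'] [TopologicalSpace X'] [MulAction G P'] [ContinuousSMul G P']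

/-- A map of principal `G`-bundles `ζ' → ζ` covering `base : X' → X` (so that `ζ'` is the pullback
of `ζ` along `base`). -/
structure BundleMap (ζ' : PrincipalBundle G P' X') (ζ : PrincipalBundle G P X) where
  base : C(X', X)
  total : C(P', P)
  proj_total : ∀ p, ζ.proj (total p) = base (ζ'.proj p)
  total_smul : ∀ (g : G) p, total (g • p) = g • total p

def BundleMap.id (ζ : PrincipalBundle G P X) : BundleMap ζ ζ where
  base := ContinuousMap.id X
  total := ContinuousMap.id P
  proj_total _ := rfl
  total_smul _ _ := rfl

variable (𝕜 : Type*) [CommRing 𝕜] [TopologicalSpace 𝕜] [IsTopologicalRing 𝕜]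

/-- Continuous `G`-equivariant algebra homomorphisms. -/
structure EquivariantHom (G F F' : Type*) [Group G]
    [NonUnitalRing F] [TopologicalSpace F] [Module 𝕜 F] [DistribMulAction G F]
    [NonUnitalRing F'] [TopologicalSpace F'] [Module 𝕜 F'] [DistribMulAction G F'] where
  toHom : F →ₙₐ[𝕜] F'
  continuous : Continuous toHom
  map_smul : ∀ (g : G) b, toHom (g • b) = g • toHom b

section

variable {𝕜}
variable {ζ : PrincipalBundle G P X} {ζ' : PrincipalBundle G P' X'}
  {F F' : Type*} [NonUnitalRing F] [TopologicalSpace F] [IsTopologicalRing F] [Module 𝕜 F]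
  [DistribMulAction G F] [ContinuousSMul G F] [MulAct G F] [SMulCommClass G 𝕜 F]
  [ContinuousConstSMul 𝕜 F]
  [NonUnitalRing F'] [TopologicalSpace F'] [IsTopologicalRing F'] [Module 𝕜 F']
  [DistribMulAction G F'] [ContinuousSMul G F'] [MulAct G F'] [SMulCommClass G 𝕜 F']
  [ContinuousConstSMul 𝕜 F']

/-- The homomorphism `Γ(X, P ×_G F) → Γ(X', P' ×_G F')` induced by a bundle map `ζ' → ζ` and an
equivariant homomorphism `α : F → F'`. -/
def secMap (m : BundleMap ζ' ζ) (α : EquivariantHom 𝕜 G F F') : Sec ζ F →ₙₐ[𝕜] Sec ζ' F' where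
  toFun s := Sec.ofEquivariant (fun p => α.toHom (s.coords (m.total p)))
    (α.continuous.comp (s.continuous_coords_apply.comp m.total.continuous))
    fun g p => by rw [m.total_smul, Sec.coords_smul, α.map_smul]
  map_smul' r s := Sec.coords_injective (by
    rw [Sec.coords_ofEquivariant, Sec.coords_rsmul, Sec.coords_rsmul, Sec.coords_ofEquivariant]
    funext p
    exact map_smul α.toHom r _)
  map_zero' := Sec.coords_injective (by
    rw [Sec.coords_ofEquivariant, Sec.coords_zero, Sec.coords_zero]
    funext p
    exact map_zero α.toHom)
  map_add' s t := Sec.coords_injective (by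
    rw [Sec.coords_ofEquivariant, Sec.coords_add, Sec.coords_add, Sec.coords_ofEquivariant,
      Sec.coords_ofEquivariant]
    funext p
    exact map_add α.toHom _ _)
  map_mul' s t := Sec.coords_injective (by
    rw [Sec.coords_ofEquivariant, Sec.coords_mul, Sec.coords_mul, Sec.coords_ofEquivariant,
      Sec.coords_ofEquivariant]
    funext p
    exact map_mul α.toHom _ _)

theorem coords_secMap (m : BundleMap ζ' ζ) (α : EquivariantHom 𝕜 G F F') (s : Sec ζ F) (p : P') :
    (secMap m α s).coords p = α.toHom (s.coords (m.total p)) :=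
  congrFun (Sec.coords_ofEquivariant (fun p => α.toHom (s.coords (m.total p)))
    (α.continuous.comp (s.continuous_coords_apply.comp m.total.continuous))
    fun g p => by rw [m.total_smul, Sec.coords_smul, α.map_smul]) p

theorem continuous_secMap [LocallyCompactSpace X] (m : BundleMap ζ' ζ)
    (α : EquivariantHom 𝕜 G F F') : Continuous (secMap m α) := by
  refine Sec.continuous_ofEquivariant (T := Sec ζ F)
    (h := fun s p => α.toHom (s.coords (m.total p))) ?_
    (fun s => α.continuous.comp (s.continuous_coords_apply.comp m.total.continuous))
    fun s g p => by rw [m.total_smul, Sec.coords_smul, α.map_smul]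
  exact α.continuous.comp (Sec.continuous_coords.comp
    (continuous_fst.prodMk (m.total.continuous.comp continuous_snd)))

end

variable {𝕜}
variable [LocallyCompactSpace X] [LocallyCompactSpace X']
variable (ζ : PrincipalBundle G P X) (ζ' : PrincipalBundle G P' X')
  {B B' : Type*} [NonUnitalRing B] [TopologicalSpace B] [IsTopologicalRing B] [Module 𝕜 B]
  [IsScalarTower 𝕜 B B] [SMulCommClass 𝕜 B B] [ContinuousSMul 𝕜 B]
  [DistribMulAction G B] [ContinuousSMul G B] [MulAct G B] [SMulCommClass G 𝕜 B]
  [NonUnitalRing B'] [TopologicalSpace B'] [IsTopologicalRing B'] [Module 𝕜 B']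
  [IsScalarTower 𝕜 B' B'] [SMulCommClass 𝕜 B' B'] [ContinuousSMul 𝕜 B']
  [DistribMulAction G B'] [ContinuousSMul G B'] [MulAct G B'] [SMulCommClass G 𝕜 B']

variable (𝕜 B)

/-- The inclusion `B → B⁺`. -/
def inclPlus : EquivariantHom 𝕜 G B (Plus 𝕜 B) where
  toHom := Plus.inrHom 𝕜 B
  continuous := Plus.continuous_rng continuous_const continuous_id
  map_smul _ _ := rfl

/-- `GL(A_ζ)`, where `A_ζ = Γ(X, P ×_G B)` is regarded as a non-unital algebra. -/
abbrev GLsec : Subgroup (Plus 𝕜 (Sec ζ B))ˣ := GLnu 𝕜 (Sec ζ B)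

/-- `GL(A_{ζ⁺})`, the group of invertible elements of `A_{ζ⁺} = Γ(X, P ×_G B⁺)`. -/
abbrev GLsecPlus : Type _ := (Sec ζ (Plus 𝕜 B))ˣ

/-- The homomorphism `GL(A_ζ) → GL(A_{ζ⁺})`, induced by `A_ζ → A_{ζ⁺}`. -/
def glIncl : GLsec 𝕜 ζ B →ₜ* GLsecPlus 𝕜 ζ B where
  toMonoidHom := (Units.map (Plus.lift (secMap (BundleMap.id ζ) (inclPlus 𝕜 B)) :
    Plus 𝕜 (Sec ζ B) →* Sec ζ (Plus 𝕜 B))).comp (GLsec 𝕜 ζ B).subtype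
  continuous_toFun := (Continuous.units_map _ (Plus.continuous_lift _
    (continuous_secMap (BundleMap.id ζ) (inclPlus 𝕜 B)))).comp continuous_subtype_val

/-- The invertible scalar `p(u(x))`, `x = ζ.proj p`. -/
def unitPart (u : GLsecPlus 𝕜 ζ B) (p : P) : 𝕜ˣ where
  val := (u.val.coords p).fst
  inv := (u⁻¹.val.coords p).fst
  val_inv := by
    rw [← Plus.fst_mul, ← Pi.mul_apply, ← Sec.coords_mul, Units.mul_inv, Sec.coords_one]
    rfl
  inv_val := by
    rw [← Plus.fst_mul, ← Pi.mul_apply, ← Sec.coords_mul, Units.inv_mul, Sec.coords_one]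
    rfl

theorem unitPart_smul (u : GLsecPlus 𝕜 ζ B) (g : G) (p : P) :
    unitPart 𝕜 ζ B u (g • p) = unitPart 𝕜 ζ B u p := by
  apply Units.ext
  change (u.val.coords (g • p)).fst = (u.val.coords p).fst
  rw [Sec.coords_smul, Plus.fst_smul]

theorem continuous_unitPart :
    Continuous fun q : GLsecPlus 𝕜 ζ B × P => unitPart 𝕜 ζ B q.1 q.2 := by
  refine Units.continuous_iff.2 ⟨?_, ?_⟩
  · exact Plus.continuous_fst.comp (Sec.continuous_coords.comp
      ((Units.continuous_val.comp continuous_fst).prodMk continuous_snd))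
  · exact Plus.continuous_fst.comp (Sec.continuous_coords.comp
      ((Units.continuous_val.comp (continuous_inv.comp continuous_fst)).prodMk continuous_snd))

/-- The homomorphism `p_* : GL(A_{ζ⁺}) → C(X, 𝕜 - 0)` induced by `B⁺ → 𝕜`. -/
def glProj : GLsecPlus 𝕜 ζ B →ₜ* C(X, 𝕜ˣ) where
  toFun u := ⟨ζ.descend (unitPart 𝕜 ζ B u),
    (ζ.continuous_descend (continuous_unitPart 𝕜 ζ B) (unitPart_smul 𝕜 ζ B)).comp
      (Continuous.prodMk_right u)⟩
  map_one' := by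
    ext x
    change (Sec.coords (1 : Sec ζ (Plus 𝕜 B)) _).fst = 1
    rw [Sec.coords_one]
    rfl
  map_mul' u v := by
    ext x
    change (Sec.coords (u.val * v.val) _).fst = (u.val.coords _).fst * (v.val.coords _).fst
    rw [Sec.coords_mul]
    rfl
  continuous_toFun := ContinuousMap.continuous_of_continuous_uncurry _
    (ζ.continuous_descend (continuous_unitPart 𝕜 ζ B) (unitPart_smul 𝕜 ζ B))

/-- The section `x ↦ f(x) · 1` of `P ×_G B⁺`. -/
def scalarSec (f : C(X, 𝕜)) : Sec ζ (Plus 𝕜 B) :=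
  Sec.ofEquivariant (fun p => Plus.mk (f (ζ.proj p)) 0)
    (Plus.continuous_rng (f.continuous.comp ζ.continuous_proj) continuous_const)
    fun g p => by
      rw [ζ.proj_smul]
      exact Plus.ext rfl (smul_zero g).symm

theorem coords_scalarSec (f : C(X, 𝕜)) (p : P) :
    (scalarSec 𝕜 ζ B f).coords p = Plus.mk (f (ζ.proj p)) 0 := by
  unfold scalarSec
  rw [Sec.coords_ofEquivariant]

theorem continuous_scalarSec : Continuous (scalarSec 𝕜 ζ B) := by
  refine Sec.continuous_ofEquivariant (T := C(X, 𝕜))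
    (h := fun f p => (Plus.mk (f (ζ.proj p)) 0 : Plus 𝕜 B)) ?_ _ _
  exact Plus.continuous_rng ((continuous_eval (F := C(X, 𝕜))).comp
    (continuous_fst.prodMk (ζ.continuous_proj.comp continuous_snd))) continuous_const

def scalarSecHom : C(X, 𝕜) →* Sec ζ (Plus 𝕜 B) where
  toFun := scalarSec 𝕜 ζ B
  map_one' := Sec.coords_injective (by
    funext p
    rw [coords_scalarSec, Sec.coords_one]
    rfl)
  map_mul' f g := Sec.coords_injective (by
    funext p
    rw [Sec.coords_mul, Pi.mul_apply, coords_scalarSec, coords_scalarSec, coords_scalarSec]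
    refine Plus.ext rfl ?_
    rw [Plus.snd_mul]
    simp [Plus.mk, Plus.snd])

/-- The canonical splitting `C(X, 𝕜 - 0) → GL(A_{ζ⁺})`, `f ↦ f · 1`, of `p_*`. -/
def glScalar : C(X, 𝕜ˣ) →ₜ* GLsecPlus 𝕜 ζ B where
  toFun f := Units.map (scalarSecHom 𝕜 ζ B) (ContinuousMap.unitsLift f)
  map_one' := by
    apply Units.ext
    exact map_one (scalarSecHom 𝕜 ζ B)
  map_mul' f g := by
    apply Units.ext
    exact map_mul (scalarSecHom 𝕜 ζ B) (ContinuousMap.unitsLift f).val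
      (ContinuousMap.unitsLift g).val
  continuous_toFun := by
    have h : Continuous fun f : C(X, 𝕜ˣ) => (ContinuousMap.unitsLift f).val :=
      ContinuousMap.continuous_postcomp (⟨Units.val, Units.continuous_val⟩ : C(𝕜ˣ, 𝕜))
    refine Units.continuous_iff.2 ⟨(continuous_scalarSec 𝕜 ζ B).comp h, ?_⟩
    exact (continuous_scalarSec 𝕜 ζ B).comp (h.comp continuous_inv)

variable {𝕜 B ζ ζ'}

/-- The unital extension `B⁺ → B'⁺` of an equivariant homomorphism `B → B'`. -/
def EquivariantHom.plus (α : EquivariantHom 𝕜 G B B') :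
    EquivariantHom 𝕜 G (Plus 𝕜 B) (Plus 𝕜 B') where
  toHom := (Plus.map α.toHom : Plus 𝕜 B →ₙₐ[𝕜] Plus 𝕜 B')
  continuous := Plus.continuous_map α.toHom α.continuous
  map_smul g b := by
    refine Plus.ext ?_ ?_
    · change Plus.fst (Plus.map α.toHom (g • b)) = Plus.fst (Plus.map α.toHom b)
      rw [Plus.fst_map, Plus.fst_map, Plus.fst_smul]
    · change Plus.snd (Plus.map α.toHom (g • b)) = g • Plus.snd (Plus.map α.toHom b)
      rw [Plus.snd_map, Plus.snd_map, Plus.snd_smul, α.map_smul]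

/-- The homomorphism `GL(A_ζ) → GL(A_{ζ'})` induced by `ζ' → ζ` and `α : B → B'`. -/
def glMap (m : BundleMap ζ' ζ) (α : EquivariantHom 𝕜 G B B') :
    GLsec 𝕜 ζ B →ₜ* GLsec 𝕜 ζ' B' where
  toMonoidHom := ((Units.map (Plus.map (secMap m α) :
      Plus 𝕜 (Sec ζ B) →* Plus 𝕜 (Sec ζ' B'))).comp (GLsec 𝕜 ζ B).subtype).codRestrict
    (GLsec 𝕜 ζ' B') fun u => by
      have hu : Plus.fst u.1.val = 1 := congrArg Units.val u.2
      refine Units.ext ?_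
      change Plus.fst (Plus.map (secMap m α) u.1.val) = 1
      rw [Plus.fst_map, hu]
  continuous_toFun := ((Continuous.units_map _ (Plus.continuous_map _
    (continuous_secMap m α))).comp continuous_subtype_val).subtype_mk _

/-- The homomorphism `GL(A_{ζ⁺}) → GL(A_{ζ'⁺})` induced by `ζ' → ζ` and `α : B → B'`. -/
def glPlusMap (m : BundleMap ζ' ζ) (α : EquivariantHom 𝕜 G B B') :
    GLsecPlus 𝕜 ζ B →ₜ* GLsecPlus 𝕜 ζ' B' where
  toMonoidHom := Units.map
    { toFun := secMap m α.plus
      map_one' := Sec.coords_injective (by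
        funext p
        rw [coords_secMap, Sec.coords_one, Sec.coords_one]
        exact map_one (Plus.map α.toHom))
      map_mul' := map_mul (secMap m α.plus) }
  continuous_toFun := Continuous.units_map _ (continuous_secMap m α.plus)

end Maps

/-- The homomorphism `C(X, 𝕜 - 0) → C(Y, 𝕜 - 0)` induced by `f : Y → X`. -/
def precompHom {X Y : Type*} [TopologicalSpace X] [TopologicalSpace Y] (𝕜 : Type*) [CommRing 𝕜]
    [TopologicalSpace 𝕜] [IsTopologicalRing 𝕜] (f : C(Y, X)) : C(X, 𝕜ˣ) →ₜ* C(Y, 𝕜ˣ) where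
  toMonoidHom := ContinuousMap.compMonoidHom' f
  continuous_toFun := ContinuousMap.continuous_precomp f

/-! ### The maps of the exact sequences -/

section Sequence

variable {G P X : Type*} [Group G] [TopologicalSpace G] [IsTopologicalGroup G]
  [TopologicalSpace P] [TopologicalSpace X] [LocallyCompactSpace X] [MulAction G P]
  [ContinuousSMul G P] (ζ : PrincipalBundle G P X)
  (B : Type*) [NonUnitalRing B] [TopologicalSpace B] [IsTopologicalRing B] [Module ℂ B]
  [IsScalarTower ℂ B B] [SMulCommClass ℂ B B] [ContinuousSMul ℂ B]
  [DistribMulAction G B] [ContinuousSMul G B] [MulAct G B] [SMulCommClass G ℂ B]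

/-- `π₀(GL A_{ζ⁺}) → π₀(C(X, ℂ - 0)) ≅ Ȟ¹(X; ℤ)`. -/
def quot0 (θ : ZerothHomotopy C(X, ℂˣ) ≃* Multiplicative (Cech X 1 ℤ)) :
    ZerothHomotopy (GLsecPlus ℂ ζ B) →* Multiplicative (Cech X 1 ℤ) :=
  θ.toMonoidHom.comp (pi0Hom (glProj ℂ ζ B))

/-- `Ȟ¹(X; ℤ) ≅ π₀(C(X, ℂ - 0)) → π₀(GL A_{ζ⁺})`. -/
def split0 (θ : ZerothHomotopy C(X, ℂˣ) ≃* Multiplicative (Cech X 1 ℤ)) :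
    Multiplicative (Cech X 1 ℤ) →* ZerothHomotopy (GLsecPlus ℂ ζ B) :=
  (pi0Hom (glScalar ℂ ζ B)).comp θ.symm.toMonoidHom

/-- `π₁(GL A_{ζ⁺}) → π₁(C(X, ℂ - 0)) ≅ Ȟ⁰(X; ℤ)`. -/
def quot1 (θ : π_ 1 C(X, ℂˣ) 1 ≃* Multiplicative (Cech X 0 ℤ)) :
    π_ 1 (GLsecPlus ℂ ζ B) 1 →* Multiplicative (Cech X 0 ℤ) :=
  θ.toMonoidHom.comp (piHom 0 (glProj ℂ ζ B))

/-- `Ȟ⁰(X; ℤ) ≅ π₁(C(X, ℂ - 0)) → π₁(GL A_{ζ⁺})`. -/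
def split1 (θ : π_ 1 C(X, ℂˣ) 1 ≃* Multiplicative (Cech X 0 ℤ)) :
    Multiplicative (Cech X 0 ℤ) →* π_ 1 (GLsecPlus ℂ ζ B) 1 :=
  (piHom 0 (glScalar ℂ ζ B)).comp θ.symm.toMonoidHom

end Sequence

/-- `cechMap`, written multiplicatively. -/
def cechMul {X Y : Type*} [TopologicalSpace X] [TopologicalSpace Y] (f : C(Y, X)) (p : ℕ) :
    Multiplicative (Cech X p ℤ) →* Multiplicative (Cech Y p ℤ) :=
  AddMonoidHom.toMultiplicative (cechMap f p ℤ)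

end SectionGL

end

open SectionGL

universe u v w z

/-!
Every invertible section `u` of `P ×_G B⁺` has an invertible scalar component `p_* u`, and the
scalar sections `σ f` are central. Hence `u ↦ u · σ(p_* u)⁻¹` splits `GL(A_{ζ⁺})` topologically as
`GL(A_ζ) × C(X, 𝔽ˣ)`, and `π_j` of the inclusion of the first factor is split injective with
cokernel `π_j C(X, 𝔽ˣ)`.

In the real case `t ↦ (1 - t) f + t` contracts every cube of functions with value `1` on the
boundary. In the complex case, lift through the covering `z ↦ exp (2πi z)` of `ℂˣ` by `ℂ`. A cube
of dimension at least `2` lifts to a cube with boundary value `0`, which contracts linearly. A loop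
lifts to a path from `0` to a locally constant integer-valued function, so `π₁ = Ȟ⁰`. A single
function lifts only locally, and the differences of its local logarithms are a Čech `1`-cocycle;
on a paracompact space a partition of unity makes every cocycle arise this way, so `π₀ = Ȟ¹`.
-/

noncomputable section

namespace SectionGL

/-! ### Direct product decompositions -/

section DirectDecomposition

variable {H K L : Type*} [Group H] [Group K] [Group L]

/-- `i` and `s` are the inclusions, `r` and `p` the projections of a decomposition of `K` as the
direct product of `H` and `L`. -/
structure IsDirectDecomposition (i : H →* K) (p : K →* L) (s : L →* K) (r : K →* H) : Prop where
  retract_comp_incl : r.comp i = MonoidHom.id H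
  proj_comp_incl : p.comp i = 1
  proj_comp_sec : p.comp s = MonoidHom.id L
  incl_retract_mul_sec_proj : ∀ x, i (r x) * s (p x) = x

namespace IsDirectDecomposition

variable {i : H →* K} {p : K →* L} {s : L →* K} {r : K →* H}

theorem injective (h : IsDirectDecomposition i p s r) : Function.Injective i :=
  Function.LeftInverse.injective (DFunLike.congr_fun h.retract_comp_incl)

theorem surjective (h : IsDirectDecomposition i p s r) : Function.Surjective p :=
  Function.RightInverse.surjective (DFunLike.congr_fun h.proj_comp_sec)

theorem range_eq_ker (h : IsDirectDecomposition i p s r) : i.range = p.ker := by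
  ext x
  constructor
  · rintro ⟨y, rfl⟩
    exact DFunLike.congr_fun h.proj_comp_incl y
  · intro hx
    refine ⟨r x, ?_⟩
    simpa only [MonoidHom.mem_ker.1 hx, map_one, mul_one] using h.incl_retract_mul_sec_proj x

theorem bijective [Subsingleton L] (h : IsDirectDecomposition i p s r) : Function.Bijective i :=
  ⟨h.injective, MonoidHom.range_eq_top.1 <| h.range_eq_ker.trans <|
    eq_top_iff.2 fun _ _ => Subsingleton.elim _ _⟩

theorem isSplitShortExact (h : IsDirectDecomposition i p s r) {C : Type*} [Group C] (θ : L ≃* C) :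
    IsSplitShortExact i (θ.toMonoidHom.comp p) (s.comp θ.symm.toMonoidHom) where
  injective := h.injective
  exact := by
    rw [h.range_eq_ker]
    ext x
    exact (map_eq_one_iff θ θ.injective).symm
  surjective := θ.surjective.comp h.surjective
  splits := by
    ext c
    exact (congrArg θ (DFunLike.congr_fun h.proj_comp_sec (θ.symm c))).trans (θ.apply_symm_apply c)

end IsDirectDecomposition

end DirectDecomposition

/-! ### Homotopy groups of topological groups -/

section Loops

open scoped unitInterval Topology.Homotopy

variable {N H : Type*} [MulOneClass H] [TopologicalSpace H] [ContinuousMul H]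

/-- The pointwise product of two loops in a topological monoid. -/
def loopMul (a b : GenLoop N H 1) : GenLoop N H 1 :=
  ⟨a.1 * b.1, fun y hy => by
    have ha : a.1 y = 1 := a.2 y hy
    have hb : b.1 y = 1 := b.2 y hy
    rw [ContinuousMap.mul_apply, ha, hb, mul_one]⟩

theorem homotopic_loopMul {a a' b b' : GenLoop N H 1}
    (ha : GenLoop.Homotopic a a') (hb : GenLoop.Homotopic b b') :
    GenLoop.Homotopic (loopMul a b) (loopMul a' b') := by
  obtain ⟨F⟩ := ha
  obtain ⟨F'⟩ := hb
  refine ⟨⟨⟨⟨fun q => F q * F' q, by fun_prop⟩, fun y => ?_, fun y => ?_⟩, fun t y hy => ?_⟩⟩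
  · exact congrArg₂ (· * ·) (F.apply_zero y) (F'.apply_zero y)
  · exact congrArg₂ (· * ·) (F.apply_one y) (F'.apply_one y)
  · exact congrArg₂ (· * ·) (F.eq_fst t hy) (F'.eq_fst t hy)

/-- The class of a loop in the homotopy group. -/
def piMk {n : ℕ} {S : Type*} [TopologicalSpace S] {x : S} (a : GenLoop (Fin n) S x) : π_ n S x :=
  Quotient.mk _ a

/-- Eckmann–Hilton: a concatenation of loops is the pointwise product of the two loops obtained by
concatenating either one with the constant loop. -/
theorem piMk_loopMul {k : ℕ} (a b : GenLoop (Fin (k + 1)) H 1) :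
    piMk (loopMul a b) = piMk a * piMk b := by
  have ha : piMk (GenLoop.transAt 0 GenLoop.const a) = piMk a :=
    HomotopyGroup.mul_spec.symm.trans (mul_one (piMk a))
  have hb : piMk (GenLoop.transAt 0 b GenLoop.const) = piMk b :=
    HomotopyGroup.mul_spec.symm.trans (one_mul (piMk b))
  have hab : loopMul (GenLoop.transAt 0 GenLoop.const a) (GenLoop.transAt 0 b GenLoop.const) =
      GenLoop.transAt 0 b a := by
    ext y
    change GenLoop.transAt 0 GenLoop.const a y * GenLoop.transAt 0 b GenLoop.const y = _
    simp only [GenLoop.transAt, GenLoop.coe_copy]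
    split_ifs <;> simp
  calc piMk (loopMul a b)
      = piMk (loopMul (GenLoop.transAt 0 GenLoop.const a) (GenLoop.transAt 0 b GenLoop.const)) :=
        (Quotient.sound (homotopic_loopMul (Quotient.exact ha) (Quotient.exact hb))).symm
    _ = piMk (GenLoop.transAt 0 b a) := congrArg piMk hab
    _ = piMk a * piMk b := HomotopyGroup.mul_spec.symm

end Loops

section HomotopyFunctors

open scoped unitInterval Topology.Homotopy

variable {H K K' L : Type*} [Group H] [TopologicalSpace H] [Group K] [TopologicalSpace K]
  [Group K'] [TopologicalSpace K'] [Group L] [TopologicalSpace L]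

theorem piHom_comp_eq (k : ℕ) {f : H →ₜ* K} {g : K →ₜ* L} {f' : H →ₜ* K'} {g' : K' →ₜ* L}
    (h : g.comp f = g'.comp f') :
    (piHom k g).comp (piHom k f) = (piHom k g').comp (piHom k f') := by
  ext ⟨a⟩
  refine congrArg piMk ?_
  ext y
  exact DFunLike.congr_fun h (a y)

namespace IsDirectDecomposition

variable {i : H →ₜ* K} {p : K →ₜ* L} {s : L →ₜ* K} {r : K →ₜ* H}

theorem pi [ContinuousMul K]
    (h : IsDirectDecomposition i.toMonoidHom p.toMonoidHom s.toMonoidHom r.toMonoidHom) (k : ℕ) :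
    IsDirectDecomposition (piHom k i) (piHom k p) (piHom k s) (piHom k r) where
  retract_comp_incl := by
    ext ⟨a⟩
    refine congrArg piMk ?_
    ext y
    exact DFunLike.congr_fun h.retract_comp_incl (a y)
  proj_comp_incl := by
    ext ⟨a⟩
    refine congrArg piMk ?_
    ext y
    exact DFunLike.congr_fun h.proj_comp_incl (a y)
  proj_comp_sec := by
    ext ⟨a⟩
    refine congrArg piMk ?_
    ext y
    exact DFunLike.congr_fun h.proj_comp_sec (a y)
  incl_retract_mul_sec_proj := by
    rintro ⟨a⟩
    refine (piMk_loopMul (genLoopMap i (genLoopMap r a)) (genLoopMap s (genLoopMap p a))).symm.trans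
      (congrArg piMk ?_)
    ext y
    exact h.incl_retract_mul_sec_proj (a y)

end IsDirectDecomposition

theorem subsingleton_pi {S : Type*} [TopologicalSpace S] {x : S} {n : ℕ}
    (h : ∀ a : GenLoop (Fin n) S x, GenLoop.Homotopic a GenLoop.const) :
    Subsingleton (π_ n S x) :=
  ⟨by
    rintro ⟨a⟩ ⟨b⟩
    exact Quotient.sound ((h a).trans (h b).symm)⟩

theorem homotopic_const_of_subsingleton_pi {S : Type*} [TopologicalSpace S] {x : S} {n : ℕ}
    [Subsingleton (π_ n S x)] (a : GenLoop (Fin n) S x) : GenLoop.Homotopic a GenLoop.const :=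
  Quotient.exact (Subsingleton.elim (piMk a) (piMk GenLoop.const))

variable [IsTopologicalGroup H] [IsTopologicalGroup K] [IsTopologicalGroup K']
  [IsTopologicalGroup L]

theorem pi0Hom_comp_eq {f : H →ₜ* K} {g : K →ₜ* L} {f' : H →ₜ* K'} {g' : K' →ₜ* L}
    (h : g.comp f = g'.comp f') :
    (pi0Hom g).comp (pi0Hom f) = (pi0Hom g').comp (pi0Hom f') := by
  ext ⟨x⟩
  exact congrArg ZerothHomotopy.mk (DFunLike.congr_fun h x)

theorem idComponentMap_comp_eq {f : H →ₜ* K} {g : K →ₜ* L} {f' : H →ₜ* K'} {g' : K' →ₜ* L}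
    (h : g.comp f = g'.comp f') :
    (idComponentMap g).comp (idComponentMap f) = (idComponentMap g').comp (idComponentMap f') := by
  ext x
  exact DFunLike.congr_fun h x.1

namespace IsDirectDecomposition

variable {i : H →ₜ* K} {p : K →ₜ* L} {s : L →ₜ* K} {r : K →ₜ* H}

theorem pi0 (h : IsDirectDecomposition i.toMonoidHom p.toMonoidHom s.toMonoidHom r.toMonoidHom) :
    IsDirectDecomposition (pi0Hom i) (pi0Hom p) (pi0Hom s) (pi0Hom r) where
  retract_comp_incl := by
    ext ⟨x⟩
    exact congrArg ZerothHomotopy.mk (DFunLike.congr_fun h.retract_comp_incl x)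
  proj_comp_incl := by
    ext ⟨x⟩
    exact congrArg ZerothHomotopy.mk (DFunLike.congr_fun h.proj_comp_incl x)
  proj_comp_sec := by
    ext ⟨x⟩
    exact congrArg ZerothHomotopy.mk (DFunLike.congr_fun h.proj_comp_sec x)
  incl_retract_mul_sec_proj := by
    rintro ⟨x⟩
    exact congrArg ZerothHomotopy.mk (h.incl_retract_mul_sec_proj x)

theorem idComponent
    (h : IsDirectDecomposition i.toMonoidHom p.toMonoidHom s.toMonoidHom r.toMonoidHom) :
    IsDirectDecomposition (idComponentMap i).toMonoidHom (idComponentMap p).toMonoidHom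
      (idComponentMap s).toMonoidHom (idComponentMap r).toMonoidHom where
  retract_comp_incl := by
    ext x
    exact DFunLike.congr_fun h.retract_comp_incl x.1
  proj_comp_incl := by
    ext x
    exact DFunLike.congr_fun h.proj_comp_incl x.1
  proj_comp_sec := by
    ext x
    exact DFunLike.congr_fun h.proj_comp_sec x.1
  incl_retract_mul_sec_proj x := Subtype.ext (h.incl_retract_mul_sec_proj x.1)

end IsDirectDecomposition

/-- A null homotopy of a loop in the identity component stays in the identity component, because
each point of the cube moves along a path. -/
instance subsingleton_pi_idComponent {n : ℕ} [Subsingleton (π_ n L 1)] :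
    Subsingleton (π_ n (idComponent L) 1) := subsingleton_pi fun a => by
  obtain ⟨F⟩ := homotopic_const_of_subsingleton_pi (x := (1 : L))
    ⟨⟨fun y => (a y : L), by fun_prop⟩, fun y hy => congrArg Subtype.val (a.2 y hy)⟩
  have hF : ∀ q, F q ∈ idComponent L := by
    rintro ⟨t, y⟩
    have h0 : Joined (1 : L) (F (0, y)) := by
      rw [F.apply_zero]
      exact (a y).2
    have ht : Joined (F (0, y)) (F (t, y)) :=
      joined_map (f := fun t => F (t, y)) (by fun_prop)
        ⟨⟨⟨(· * t), by fun_prop⟩, zero_mul t, one_mul t⟩⟩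
    exact h0.trans ht
  refine ⟨⟨⟨⟨fun q => ⟨F q, hF q⟩, by fun_prop⟩, fun y => ?_, fun y => ?_⟩, fun t y hy => ?_⟩⟩
  · exact Subtype.ext (F.apply_zero y)
  · exact Subtype.ext (F.apply_one y)
  · exact Subtype.ext (F.eq_fst t hy)

theorem IsDirectDecomposition.bijective_piHom_idComponentMap {i : H →ₜ* K} {p : K →ₜ* L}
    {s : L →ₜ* K} {r : K →ₜ* H}
    (h : IsDirectDecomposition i.toMonoidHom p.toMonoidHom s.toMonoidHom r.toMonoidHom) (k : ℕ)
    [Subsingleton (π_ (k + 1) L 1)] : Function.Bijective (piHom k (idComponentMap i)) :=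
  (h.idComponent.pi k).bijective

end HomotopyFunctors

/-! ### The splitting of the group of invertible sections -/

section CentralQuotient

variable {K : Type*} [Group K] [TopologicalSpace K] [IsTopologicalGroup K]

/-- The endomorphism `x ↦ x * (c x)⁻¹`, where `c` is an endomorphism with central values. It is the
projection onto `ker c` when `c` is idempotent. -/
def divCentral (c : K →ₜ* K) (hc : ∀ x y, Commute (c x) y) : K →ₜ* K where
  toFun x := x * (c x)⁻¹
  map_one' := by rw [map_one, inv_one, mul_one]
  map_mul' x y := by
    calc x * y * (c (x * y))⁻¹
        = x * (y * (c x)⁻¹) * (c y)⁻¹ := by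
          rw [map_mul, (hc x (c y)).eq, mul_inv_rev]
          simp only [mul_assoc]
      _ = x * ((c x)⁻¹ * y) * (c y)⁻¹ := by rw [(hc x y).inv_left.eq]
      _ = x * (c x)⁻¹ * (y * (c y)⁻¹) := by simp only [mul_assoc]
  continuous_toFun := continuous_id.mul (map_continuous c).inv

theorem divCentral_apply (c : K →ₜ* K) (hc : ∀ x y, Commute (c x) y) (x : K) :
    divCentral c hc x = x * (c x)⁻¹ := rfl

end CentralQuotient

section Retraction

variable {G P X : Type*} [Group G] [TopologicalSpace G] [TopologicalSpace P] [TopologicalSpace X]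
  [MulAction G P] {𝕜 : Type*} [CommRing 𝕜] [TopologicalSpace 𝕜] {ζ : PrincipalBundle G P X}
  {B : Type*} [NonUnitalRing B] [TopologicalSpace B] [Module 𝕜 B]
  [IsScalarTower 𝕜 B B] [SMulCommClass 𝕜 B B]
  [DistribMulAction G B] [MulAct G B] [SMulCommClass G 𝕜 B]

theorem snd_coords_smul (s : Sec ζ (Plus 𝕜 B)) (g : G) (p : P) :
    (s.coords (g • p)).snd = g • (s.coords p).snd := by
  rw [Sec.coords_smul, Plus.snd_smul]

variable [IsTopologicalGroup G] [ContinuousSMul G P] [ContinuousSMul G B]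

theorem continuous_snd_coords (s : Sec ζ (Plus 𝕜 B)) : Continuous fun p => (s.coords p).snd :=
  Plus.continuous_snd.comp s.continuous_coords_apply

/-- The element `1 + b` of `(A_ζ)⁺`, where `b` is the component in `A_ζ` of a section of
`P ×_G B⁺`. -/
def onePlus (s : Sec ζ (Plus 𝕜 B)) : Plus 𝕜 (Sec ζ B) :=
  Plus.mk 1 (Sec.ofEquivariant (fun p => (s.coords p).snd) (continuous_snd_coords s)
    (snd_coords_smul s))

theorem coords_snd_onePlus (s : Sec ζ (Plus 𝕜 B)) (p : P) :
    (Plus.snd (onePlus s)).coords p = (s.coords p).snd :=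
  congrFun (Sec.coords_ofEquivariant (ζ := ζ) (fun p => (s.coords p).snd)
    (continuous_snd_coords s) (snd_coords_smul s)) p

theorem continuous_onePlus [LocallyCompactSpace X] :
    Continuous (onePlus : Sec ζ (Plus 𝕜 B) → Plus 𝕜 (Sec ζ B)) :=
  Plus.continuous_rng continuous_const <|
    Sec.continuous_ofEquivariant (T := Sec ζ (Plus 𝕜 B))
      (h := fun s p => (s.coords p).snd) (Plus.continuous_snd.comp Sec.continuous_coords)
      continuous_snd_coords snd_coords_smul

variable [IsTopologicalRing B] [ContinuousSMul 𝕜 B]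

theorem fst_glSec (u : GLsec 𝕜 ζ B) : Plus.fst u.1.val = 1 := congrArg Units.val u.2

theorem glSec_ext {u v : GLsec 𝕜 ζ B}
    (h : ∀ p, (Plus.snd u.1.val).coords p = (Plus.snd v.1.val).coords p) : u = v :=
  Subtype.ext <| Units.ext <|
    Plus.ext ((fst_glSec u).trans (fst_glSec v).symm) (Sec.coords_injective (funext h))

variable [IsTopologicalRing 𝕜]

theorem onePlus_one : onePlus (1 : Sec ζ (Plus 𝕜 B)) = 1 := by
  refine Plus.ext rfl (Sec.coords_injective (funext fun p => ?_))
  rw [coords_snd_onePlus, Sec.coords_one]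
  exact (congrFun (Sec.coords_zero (ζ := ζ) (F := B)) p).symm

theorem onePlus_mul {s t : Sec ζ (Plus 𝕜 B)} (hs : ∀ p, (s.coords p).fst = 1)
    (ht : ∀ p, (t.coords p).fst = 1) : onePlus (s * t) = onePlus s * onePlus t := by
  refine Plus.ext (one_mul (1 : 𝕜)).symm (Sec.coords_injective (funext fun p => ?_))
  have hsnd : (onePlus s * onePlus t).snd =
      (1 : 𝕜) • (onePlus t).snd + (1 : 𝕜) • (onePlus s).snd + (onePlus s).snd * (onePlus t).snd :=
    Plus.snd_mul _ _
  rw [hsnd, coords_snd_onePlus, Sec.coords_mul, Pi.mul_apply, Plus.snd_mul, hs, ht]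
  simp only [one_smul, Sec.coords_add, Sec.coords_mul, Pi.add_apply, Pi.mul_apply,
    coords_snd_onePlus]

theorem glSecPlus_ext {u v : GLsecPlus 𝕜 ζ B} (h : ∀ p, u.val.coords p = v.val.coords p) :
    u = v :=
  Units.ext (Sec.coords_injective (funext h))

theorem coords_glSecPlus_mul (u v : GLsecPlus 𝕜 ζ B) (p : P) :
    (u * v).val.coords p = u.val.coords p * v.val.coords p :=
  congrFun (Sec.coords_mul u.val v.val) p

variable [LocallyCompactSpace X]

theorem coords_glScalar (f : C(X, 𝕜ˣ)) (p : P) :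
    (glScalar 𝕜 ζ B f).val.coords p = Plus.mk (f (ζ.proj p) : 𝕜) 0 :=
  coords_scalarSec 𝕜 ζ B _ p

theorem glProj_proj (u : GLsecPlus 𝕜 ζ B) (p : P) :
    (glProj 𝕜 ζ B u (ζ.proj p) : 𝕜) = (u.val.coords p).fst :=
  congrArg Units.val (ζ.descend_proj (unitPart_smul 𝕜 ζ B u) p)

theorem coords_glIncl (u : GLsec 𝕜 ζ B) (p : P) :
    (glIncl 𝕜 ζ B u).val.coords p = Plus.mk 1 ((Plus.snd u.1.val).coords p) := by
  change (algebraMap 𝕜 (Sec ζ (Plus 𝕜 B)) (Plus.fst u.1.val) +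
    secMap (BundleMap.id ζ) (inclPlus 𝕜 B) (Plus.snd u.1.val)).coords p = _
  rw [fst_glSec, map_one, Sec.coords_add, Pi.add_apply, Sec.coords_one, coords_secMap]
  exact Plus.ext (add_zero 1) (zero_add _)

theorem glProj_eq_iff {u : GLsecPlus 𝕜 ζ B} {f : C(X, 𝕜ˣ)} :
    glProj 𝕜 ζ B u = f ↔ ∀ p, (u.val.coords p).fst = f (ζ.proj p) := by
  constructor
  · rintro rfl p
    exact (glProj_proj u p).symm
  · intro h
    ext x
    obtain ⟨p, rfl⟩ := ζ.proj_surjective x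
    rw [glProj_proj, h]

theorem glProj_glScalar (f : C(X, 𝕜ˣ)) : glProj 𝕜 ζ B (glScalar 𝕜 ζ B f) = f :=
  glProj_eq_iff.2 fun p => congrArg Plus.fst (coords_glScalar f p)

theorem glProj_glIncl (u : GLsec 𝕜 ζ B) : glProj 𝕜 ζ B (glIncl 𝕜 ζ B u) = 1 :=
  glProj_eq_iff.2 fun p => congrArg Plus.fst (coords_glIncl u p)

theorem commute_glScalar (f : C(X, 𝕜ˣ)) (u : GLsecPlus 𝕜 ζ B) :
    Commute (glScalar 𝕜 ζ B f) u :=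
  glSecPlus_ext fun p => by
    rw [coords_glSecPlus_mul, coords_glSecPlus_mul, coords_glScalar]
    refine Plus.ext (mul_comm _ _) ?_
    rw [Plus.snd_mul, Plus.snd_mul]
    simp [Plus.mk, Plus.snd, Plus.fst]

variable (𝕜 ζ B) in
/-- The endomorphism `u ↦ u · σ(p_* u)⁻¹` of `GL(A_{ζ⁺})`, a projection onto `ker p_*`. -/
def glNormalize : GLsecPlus 𝕜 ζ B →ₜ* GLsecPlus 𝕜 ζ B :=
  divCentral ((glScalar 𝕜 ζ B).comp (glProj 𝕜 ζ B)) fun _ v => commute_glScalar _ v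

theorem glNormalize_apply (u : GLsecPlus 𝕜 ζ B) :
    glNormalize 𝕜 ζ B u = u * (glScalar 𝕜 ζ B (glProj 𝕜 ζ B u))⁻¹ := divCentral_apply _ _ u

theorem fst_coords_glNormalize (u : GLsecPlus 𝕜 ζ B) :
    ∀ p, ((glNormalize 𝕜 ζ B u).val.coords p).fst = 1 := by
  have h : glProj 𝕜 ζ B (glNormalize 𝕜 ζ B u) = 1 := by
    rw [glNormalize_apply, map_mul, map_inv, glProj_glScalar, mul_inv_cancel]
  exact glProj_eq_iff.1 h

theorem onePlus_glNormalize_mul (u v : GLsecPlus 𝕜 ζ B) :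
    onePlus (glNormalize 𝕜 ζ B (u * v)).val =
      onePlus (glNormalize 𝕜 ζ B u).val * onePlus (glNormalize 𝕜 ζ B v).val := by
  rw [map_mul]
  exact onePlus_mul (fst_coords_glNormalize u) (fst_coords_glNormalize v)

theorem onePlus_glNormalize_one : onePlus (glNormalize 𝕜 ζ B 1).val = 1 := by
  rw [map_one]
  exact onePlus_one

variable (𝕜 ζ B) in
/-- The retraction of `GL(A_{ζ⁺})` onto `GL(A_ζ)`. -/
def glRetract : GLsecPlus 𝕜 ζ B →ₜ* GLsec 𝕜 ζ B where
  toFun u := ⟨⟨onePlus (glNormalize 𝕜 ζ B u).val, onePlus (glNormalize 𝕜 ζ B u⁻¹).val,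
    by rw [← onePlus_glNormalize_mul, mul_inv_cancel, onePlus_glNormalize_one],
    by rw [← onePlus_glNormalize_mul, inv_mul_cancel, onePlus_glNormalize_one]⟩, Units.ext rfl⟩
  map_one' := Subtype.ext (Units.ext onePlus_glNormalize_one)
  map_mul' u v := Subtype.ext (Units.ext (onePlus_glNormalize_mul u v))
  continuous_toFun := by
    have h : Continuous fun u : GLsecPlus 𝕜 ζ B => onePlus (glNormalize 𝕜 ζ B u).val :=
      continuous_onePlus.comp (Units.continuous_val.comp (map_continuous (glNormalize 𝕜 ζ B)))
    exact (Units.continuous_iff.2 ⟨h, h.comp continuous_inv⟩).subtype_mk _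

theorem coords_snd_glRetract (u : GLsecPlus 𝕜 ζ B) (p : P) :
    (Plus.snd (glRetract 𝕜 ζ B u).1.val).coords p = ((glNormalize 𝕜 ζ B u).val.coords p).snd :=
  coords_snd_onePlus _ p

theorem glIncl_glRetract (u : GLsecPlus 𝕜 ζ B) :
    glIncl 𝕜 ζ B (glRetract 𝕜 ζ B u) = glNormalize 𝕜 ζ B u :=
  glSecPlus_ext fun p => by
    rw [coords_glIncl, coords_snd_glRetract]
    exact Plus.ext (fst_coords_glNormalize u p).symm rfl

theorem glRetract_glIncl (u : GLsec 𝕜 ζ B) : glRetract 𝕜 ζ B (glIncl 𝕜 ζ B u) = u :=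
  glSec_ext fun p => by
    rw [coords_snd_glRetract, glNormalize_apply, glProj_glIncl, map_one, inv_one, mul_one,
      coords_glIncl]
    rfl

variable (𝕜 ζ B) in
theorem isDirectDecomposition_gl :
    IsDirectDecomposition (glIncl 𝕜 ζ B).toMonoidHom (glProj 𝕜 ζ B).toMonoidHom
      (glScalar 𝕜 ζ B).toMonoidHom (glRetract 𝕜 ζ B).toMonoidHom where
  retract_comp_incl := MonoidHom.ext glRetract_glIncl
  proj_comp_incl := MonoidHom.ext glProj_glIncl
  proj_comp_sec := MonoidHom.ext glProj_glScalar
  incl_retract_mul_sec_proj u := by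
    change glIncl 𝕜 ζ B (glRetract 𝕜 ζ B u) * glScalar 𝕜 ζ B (glProj 𝕜 ζ B u) = u
    rw [glIncl_glRetract, glNormalize_apply, inv_mul_cancel_right]

variable {P' X' : Type*} [TopologicalSpace P'] [TopologicalSpace X']
  [MulAction G P'] [ContinuousSMul G P'] {ζ' : PrincipalBundle G P' X'}
  {B' : Type*} [NonUnitalRing B'] [TopologicalSpace B'] [IsTopologicalRing B'] [Module 𝕜 B']
  [IsScalarTower 𝕜 B' B'] [SMulCommClass 𝕜 B' B'] [ContinuousSMul 𝕜 B']
  [DistribMulAction G B'] [ContinuousSMul G B'] [MulAct G B'] [SMulCommClass G 𝕜 B']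
  (m : BundleMap ζ' ζ) (α : EquivariantHom 𝕜 G B B')

theorem coords_glPlusMap (u : GLsecPlus 𝕜 ζ B) (p : P') :
    (glPlusMap m α u).val.coords p = Plus.map α.toHom (u.val.coords (m.total p)) :=
  coords_secMap m α.plus u.val p

theorem coords_snd_glMap (u : GLsec 𝕜 ζ B) (p : P') :
    (Plus.snd (glMap m α u).1.val).coords p = α.toHom ((Plus.snd u.1.val).coords (m.total p)) := by
  change (Plus.map (secMap m α) u.1.val).snd.coords p = _
  rw [Plus.snd_map, coords_secMap]

variable [LocallyCompactSpace X']

theorem glIncl_comp_glMap :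
    (glIncl 𝕜 ζ' B').comp (glMap m α) = (glPlusMap m α).comp (glIncl 𝕜 ζ B) := by
  ext1 u
  refine glSecPlus_ext fun p => ?_
  change (glIncl 𝕜 ζ' B' (glMap m α u)).val.coords p =
    (glPlusMap m α (glIncl 𝕜 ζ B u)).val.coords p
  rw [coords_glIncl, coords_glPlusMap, coords_glIncl, coords_snd_glMap]
  refine Plus.ext ?_ ?_
  · rw [Plus.fst_map]
    rfl
  · rw [Plus.snd_map]
    rfl

theorem glProj_comp_glPlusMap :
    (glProj 𝕜 ζ' B').comp (glPlusMap m α) = (precompHom 𝕜 m.base).comp (glProj 𝕜 ζ B) := by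
  ext1 u
  refine glProj_eq_iff.2 fun p => ?_
  change ((glPlusMap m α u).val.coords p).fst = (glProj 𝕜 ζ B u (m.base (ζ'.proj p)) : 𝕜)
  rw [coords_glPlusMap, Plus.fst_map, ← m.proj_total, glProj_proj]

theorem glScalar_comp_precompHom :
    (glScalar 𝕜 ζ' B').comp (precompHom 𝕜 m.base) = (glPlusMap m α).comp (glScalar 𝕜 ζ B) := by
  ext1 f
  refine glSecPlus_ext fun p => ?_
  change (glScalar 𝕜 ζ' B' (precompHom 𝕜 m.base f)).val.coords p =
    (glPlusMap m α (glScalar 𝕜 ζ B f)).val.coords p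
  rw [coords_glScalar, coords_glPlusMap, coords_glScalar]
  refine Plus.ext ?_ ?_
  · rw [Plus.fst_map]
    exact congrArg (fun x => (f x : 𝕜)) (m.proj_total p).symm
  · rw [Plus.snd_map]
    exact (map_zero α.toHom).symm

end Retraction

/-! ### The universal covering of `ℂˣ` and loops in `C(X, ℂˣ)` -/

section Exponential

open scoped unitInterval Topology.Homotopy

/-- The universal covering `z ↦ exp (2πiz)` of `ℂˣ`. -/
def unitExp (z : ℂ) : ℂˣ := Units.mk0 (Complex.exp (2 * Real.pi * Complex.I * z))
  (Complex.exp_ne_zero _)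

theorem val_unitExp (z : ℂ) : (unitExp z : ℂ) = Complex.exp (2 * Real.pi * Complex.I * z) := rfl

theorem unitExp_add (z w : ℂ) : unitExp (z + w) = unitExp z * unitExp w := by
  ext
  simp [val_unitExp, mul_add, Complex.exp_add]

theorem unitExp_zero : unitExp 0 = 1 := by
  ext
  simp [val_unitExp]

theorem unitExp_neg (z : ℂ) : unitExp (-z) = (unitExp z)⁻¹ := by
  rw [eq_inv_iff_mul_eq_one, ← unitExp_add, neg_add_cancel, unitExp_zero]

theorem unitExp_sub (z w : ℂ) : unitExp (z - w) = unitExp z / unitExp w := by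
  rw [sub_eq_add_neg, unitExp_add, unitExp_neg, div_eq_mul_inv]

theorem unitExp_eq_one_iff {z : ℂ} : unitExp z = 1 ↔ ∃ n : ℤ, z = n := by
  rw [Units.ext_iff, val_unitExp, Units.val_one, Complex.exp_eq_one_iff]
  refine exists_congr fun n => ?_
  rw [mul_comm]
  exact mul_left_inj' Complex.two_pi_I_ne_zero

theorem unitExp_intCast (n : ℤ) : unitExp n = 1 := unitExp_eq_one_iff.2 ⟨n, rfl⟩

theorem unitExp_eq_iff {z w : ℂ} : unitExp z = unitExp w ↔ ∃ n : ℤ, z - w = n := by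
  rw [← unitExp_eq_one_iff, unitExp_sub, div_eq_one]

theorem isCoveringMap_unitExp : IsCoveringMap unitExp := by
  have h := (Complex.isCoveringMap_exp.comp_homeomorph
    (Homeomorph.mulLeft₀ (2 * Real.pi * Complex.I) Complex.two_pi_I_ne_zero)).homeomorph_comp
    (unitsHomeomorphNeZero (G₀ := ℂ)).symm
  convert h using 1
  funext z
  apply (unitsHomeomorphNeZero (G₀ := ℂ)).injective
  simp only [Function.comp_apply, Homeomorph.apply_symm_apply]
  rfl

@[fun_prop]
theorem continuous_unitExp : Continuous unitExp := isCoveringMap_unitExp.continuous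

theorem eq_of_unitExp_eq {A : Type*} [TopologicalSpace A] [PreconnectedSpace A] {g : A → ℂ}
    (hg : Continuous g) {c : ℂˣ} (h : ∀ a, unitExp (g a) = c) (a b : A) : g a = g b := by
  have := isCoveringMap_unitExp.eq_of_comp_eq hg (continuous_const (y := g b))
    (funext fun x => (h x).trans (h b).symm) b rfl
  exact congrFun this a

theorem exists_lift_unitExp {A : Type*} [TopologicalSpace A] (F : C(I × A, ℂˣ)) (g : C(A, ℂ))
    (h : ∀ a, F (0, a) = unitExp (g a)) :
    ∃ F' : C(I × A, ℂ), (∀ q, unitExp (F' q) = F q) ∧ ∀ a, F' (0, a) = g a :=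
  ⟨isCoveringMap_unitExp.liftHomotopy F g h,
    fun q => congrFun (isCoveringMap_unitExp.liftHomotopy_lifts F g h) q,
    isCoveringMap_unitExp.liftHomotopy_zero F g h⟩

variable {X : Type*} [TopologicalSpace X]

theorem joined_of_eq_unitExp {f f' : C(X, ℂˣ)} {g : X → ℂ} (hg : Continuous g)
    (h : ∀ x, f' x = unitExp (g x) * f x) : Joined f f' := by
  refine ⟨⟨⟨fun t => ⟨fun x => unitExp (t * g x) * f x, by fun_prop⟩, ?_⟩, ?_, ?_⟩⟩
  · refine ContinuousMap.continuous_of_continuous_uncurry _ ?_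
    change Continuous fun q : I × X => unitExp (q.1 * g q.2) * f q.2
    fun_prop
  · ext x
    simp [unitExp_zero]
  · ext x
    simp [h]

theorem exists_eq_unitExp_of_joined [LocallyCompactSpace X] {f : C(X, ℂˣ)} (h : Joined 1 f) :
    ∃ g : C(X, ℂ), ∀ x, f x = unitExp (g x) := by
  obtain ⟨γ⟩ := h
  obtain ⟨F, hF, -⟩ := exists_lift_unitExp (A := X)
    ⟨fun q => γ q.1 q.2, by fun_prop⟩ 0 fun x => by simp [unitExp_zero]
  refine ⟨⟨fun x => F (1, x), by fun_prop⟩, fun x => ?_⟩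
  have := hF (1, x)
  simp only [ContinuousMap.coe_mk, Path.target] at this ⊢
  exact this.symm

end Exponential

section Loops

open scoped unitInterval Topology.Homotopy

variable {X : Type*} [TopologicalSpace X]

theorem homotopic_of_lifts {n : ℕ} {a b : GenLoop (Fin n) C(X, ℂˣ) 1}
    {g g' : C((Fin n → I) × X, ℂ)} (hg : ∀ y x, unitExp (g (y, x)) = a y x)
    (hg' : ∀ y x, unitExp (g' (y, x)) = b y x)
    (h : ∀ y ∈ Cube.boundary (Fin n), ∀ x, g (y, x) = g' (y, x)) : GenLoop.Homotopic a b := by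
  refine ⟨⟨⟨⟨fun q => ⟨fun x => unitExp (g (q.2, x) + q.1 * (g' (q.2, x) - g (q.2, x))),
    by fun_prop⟩, ?_⟩, fun y => ?_, fun y => ?_⟩, fun t y hy => ?_⟩⟩
  · refine ContinuousMap.continuous_of_continuous_uncurry _ ?_
    change Continuous fun q : (I × (Fin n → I)) × X =>
      unitExp (g (q.1.2, q.2) + q.1.1 * (g' (q.1.2, q.2) - g (q.1.2, q.2)))
    fun_prop
  · ext x
    simp [hg]
  · ext x
    simp [hg']
  · ext x
    simp [← hg, h y hy]

theorem exists_lift_genLoop [LocallyCompactSpace X] {n : ℕ} (hn : 0 < n)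
    (a : GenLoop (Fin n) C(X, ℂˣ) 1) :
    ∃ g : C((Fin n → I) × X, ℂ), (∀ y x, unitExp (g (y, x)) = a y x) ∧ ∀ x, g (0, x) = 0 := by
  have h0 : a 0 = 1 := a.2 0 ⟨⟨0, hn⟩, Or.inl rfl⟩
  obtain ⟨F, hF, hF0⟩ := exists_lift_unitExp (A := (Fin n → I) × X)
    ⟨fun q => a (fun i => q.1 * q.2.1 i) q.2.2, by fun_prop⟩ 0 fun q => by
      simp only [ContinuousMap.coe_mk, zero_mul, ContinuousMap.zero_apply, unitExp_zero]
      exact DFunLike.congr_fun h0 q.2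
  refine ⟨⟨fun q => F (1, q), by fun_prop⟩, fun y x => ?_, fun x => ?_⟩
  · simpa using hF (1, (y, x))
  · have := eq_of_unitExp_eq (g := fun t : I => F (t, (0, x))) (by fun_prop) (c := 1)
      (fun t => by
        rw [hF]
        simp only [ContinuousMap.coe_mk, Pi.zero_apply, mul_zero]
        exact DFunLike.congr_fun h0 x) 1 0
    exact this.trans (hF0 _)

theorem lift_eq_of_homotopic [LocallyCompactSpace X] {n : ℕ} {a b : GenLoop (Fin n) C(X, ℂˣ) 1}
    (hab : GenLoop.Homotopic a b) {g g' : C((Fin n → I) × X, ℂ)}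
    (hg : ∀ y x, unitExp (g (y, x)) = a y x) (hg' : ∀ y x, unitExp (g' (y, x)) = b y x)
    (h0 : ∀ x, g (0, x) = g' (0, x)) {y : Fin n → I} (hy : y ∈ Cube.boundary (Fin n)) (x : X) :
    g (y, x) = g' (y, x) := by
  obtain ⟨F⟩ := hab
  obtain ⟨G, hG, hG0⟩ := exists_lift_unitExp (A := (Fin n → I) × X)
    ⟨fun q => F (q.1, q.2.1) q.2.2, by fun_prop⟩ g fun q =>
      (DFunLike.congr_fun (F.apply_zero q.1) q.2).trans (hg q.1 q.2).symm
  have hG1 : ∀ y ∈ Cube.boundary (Fin n), G (1, (y, x)) = g (y, x) := fun y hy =>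
    (eq_of_unitExp_eq (g := fun t : I => G (t, (y, x))) (by fun_prop) (fun t =>
      (hG (t, (y, x))).trans (DFunLike.congr_fun (F.eq_fst t hy) x)) 1 0).trans (hG0 (y, x))
  have hGg' : (fun y => G (1, (y, x))) = fun y => g' (y, x) :=
    isCoveringMap_unitExp.eq_of_comp_eq (by fun_prop) (by fun_prop)
      (funext fun y => ((hG (1, (y, x))).trans (DFunLike.congr_fun (F.apply_one y) x)).trans
        (hg' y x).symm)
      0 ((hG1 0 (hy.imp fun _ _ => Or.inl rfl)).trans (h0 x))
  exact (hG1 y hy).symm.trans (congrFun hGg' y)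

theorem lift_update_eq {n : ℕ} {a : GenLoop (Fin n) C(X, ℂˣ) 1} {g : C((Fin n → I) × X, ℂ)}
    (hg : ∀ y x, unitExp (g (y, x)) = a y x) (i : Fin n) {c : I} (hc : c = 0 ∨ c = 1)
    (y y' : Fin n → I) (x : X) :
    g (Function.update y i c, x) = g (Function.update y' i c, x) := by
  have : Continuous fun y : Fin n → I => Function.update y i c :=
    continuous_id.update i continuous_const
  refine eq_of_unitExp_eq (g := fun y => g (Function.update y i c, x)) (by fun_prop) (c := 1)
    (fun y => ?_) y y'
  have ha : a (Function.update y i c) = 1 :=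
    a.2 _ ⟨i, by rwa [Function.update_self]⟩
  rw [hg, ha, ContinuousMap.one_apply]

/-- In dimension at least two, each face of the cube meets a face through the origin. -/
theorem lift_eq_zero_of_mem_boundary {n : ℕ} (hn : 2 ≤ n) {a : GenLoop (Fin n) C(X, ℂˣ) 1}
    {g : C((Fin n → I) × X, ℂ)} (hg : ∀ y x, unitExp (g (y, x)) = a y x)
    (hg0 : ∀ x, g (0, x) = 0) {y : Fin n → I} (hy : y ∈ Cube.boundary (Fin n)) (x : X) :
    g (y, x) = 0 := by
  obtain ⟨i, hi⟩ := hy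
  have : Nontrivial (Fin n) := Fin.nontrivial_iff_two_le.2 hn
  obtain ⟨j, hj⟩ := exists_ne i
  have hcorner : Function.update (Function.update (0 : Fin n → I) i (y i)) j 0 =
      Function.update (0 : Fin n → I) i (y i) := by
    rw [Function.update_eq_iff]
    simp [Function.update_of_ne hj]
  calc g (y, x) = g (Function.update y i (y i), x) := by rw [Function.update_eq_self]
    _ = g (Function.update (0 : Fin n → I) i (y i), x) := lift_update_eq hg i hi y 0 x
    _ = g (Function.update (Function.update (0 : Fin n → I) i (y i)) j 0, x) := by rw [hcorner]
    _ = g (Function.update (0 : Fin n → I) j 0, x) := lift_update_eq hg j (Or.inl rfl) _ 0 x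
    _ = g (0, x) := congrArg (fun y => g (y, x)) (Function.update_eq_self j 0)
    _ = 0 := hg0 x

theorem subsingleton_pi_complex [LocallyCompactSpace X] {n : ℕ} (hn : 2 ≤ n) :
    Subsingleton (π_ n C(X, ℂˣ) 1) := subsingleton_pi fun a => by
  obtain ⟨g, hg, hg0⟩ := exists_lift_genLoop (two_pos.trans_le hn) a
  exact homotopic_of_lifts (g' := 0) hg (fun _ _ => unitExp_zero)
    fun _ hy => lift_eq_zero_of_mem_boundary hn hg hg0 hy

end Loops

section RealLoops

open scoped unitInterval Topology.Homotopy

variable {X : Type*} [TopologicalSpace X]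

theorem genLoop_real_pos {n : ℕ} (hn : 0 < n) (a : GenLoop (Fin n) C(X, ℝˣ) 1) (y : Fin n → I)
    (x : X) : 0 < (a y x : ℝ) := by
  by_contra hy
  have ha0 : (a 0 x : ℝ) = 1 :=
    congrArg Units.val (DFunLike.congr_fun (a.2 0 ⟨⟨0, hn⟩, Or.inl rfl⟩) x)
  have hcont : Continuous fun y => (a y x : ℝ) := Units.continuous_val.comp (by fun_prop)
  obtain ⟨z, hz⟩ := mem_range_of_exists_le_of_exists_ge hcont (c := 0) ⟨y, not_lt.1 hy⟩
    ⟨0, ha0.symm ▸ zero_le_one⟩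
  exact (a z x).ne_zero hz

theorem segment_one_pos {r : ℝ} (hr : 0 < r) (t : I) : 0 < (1 - t) * r + t := by
  simpa using convex_Ioi (0 : ℝ) hr (Set.mem_Ioi.2 one_pos) (sub_nonneg.2 t.2.2) t.2.1
    (sub_add_cancel 1 _)

theorem subsingleton_pi_real [LocallyCompactSpace X] {n : ℕ} (hn : 0 < n) :
    Subsingleton (π_ n C(X, ℝˣ) 1) := subsingleton_pi fun a => by
  let F (q : I × (Fin n → I)) (x : X) : ℝˣ :=
    Units.mk0 ((1 - q.1) * a q.2 x + q.1) (segment_one_pos (genLoop_real_pos hn a q.2 x) q.1).ne'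
  have hF : Continuous fun q : (I × (Fin n → I)) × X => F q.1 q.2 := by
    refine Units.isEmbedding_val₀.continuous_iff.2 ?_
    have : Continuous fun q : (I × (Fin n → I)) × X => (a q.1.2 q.2 : ℝ) :=
      Units.continuous_val.comp (by fun_prop)
    change Continuous fun q : (I × (Fin n → I)) × X =>
      (1 - q.1.1 : ℝ) * a q.1.2 q.2 + q.1.1
    fun_prop
  refine ⟨⟨⟨⟨fun q => ⟨F q, hF.comp (Continuous.prodMk_right q)⟩,
    ContinuousMap.continuous_of_continuous_uncurry _ hF⟩, fun y => ?_, fun y => ?_⟩,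
    fun t y hy => ?_⟩⟩
  · ext x
    simp [F]
  · ext x
    simp [F]
  · have ha : ∀ x, (a y x : ℝ) = 1 := fun x =>
      congrArg Units.val (DFunLike.congr_fun (a.2 y hy) x)
    ext x
    change (1 - t : ℝ) * a y x + t = a y x
    rw [ha, mul_one, sub_add_cancel]

end RealLoops

/-! ### The fundamental group of `C(X, ℂˣ)` -/

section FundamentalGroup

open scoped unitInterval Topology.Homotopy

variable {X Y : Type*} [TopologicalSpace X] [TopologicalSpace Y]

/-- The loop `t ↦ exp (2πi t n)` in `C(X, ℂˣ)`. -/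
def expLoop (n : LocallyConstant X ℤ) : GenLoop (Fin 1) C(X, ℂˣ) 1 :=
  ⟨⟨fun y => ⟨fun x => unitExp ((y 0 : ℝ) * (n x : ℂ)), by
      have := n.continuous
      fun_prop⟩, by
    refine ContinuousMap.continuous_of_continuous_uncurry _ ?_
    change Continuous fun q : (Fin 1 → I) × X => unitExp ((q.1 0 : ℝ) * (n q.2 : ℂ))
    have := n.continuous
    fun_prop⟩, by
    rintro y ⟨i, hi⟩
    rw [Subsingleton.elim i 0] at hi
    ext1 x
    change unitExp ((y 0 : ℝ) * (n x : ℂ)) = 1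
    rcases hi with hi | hi
    · simp [hi, unitExp_zero]
    · simp [hi, unitExp_intCast]⟩

theorem expLoop_add (m n : LocallyConstant X ℤ) :
    expLoop (m + n) = loopMul (expLoop m) (expLoop n) := by
  ext y x : 2
  change unitExp ((y 0 : ℝ) * ((m x + n x : ℤ) : ℂ)) =
    unitExp ((y 0 : ℝ) * (m x : ℂ)) * unitExp ((y 0 : ℝ) * (n x : ℂ))
  rw [← unitExp_add, ← mul_add, Int.cast_add]

variable (X) in
/-- The homomorphism `C(X, ℤ) → π₁ C(X, ℂˣ)`, `n ↦ [t ↦ exp (2πi t n)]`. -/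
def expLoopHom : Multiplicative (LocallyConstant X ℤ) →* π_ 1 C(X, ℂˣ) 1 :=
  MonoidHom.mk' (fun n => piMk (expLoop n.toAdd)) fun m n => by
    rw [toAdd_mul, expLoop_add, piMk_loopMul]

theorem expLoopHom_injective [LocallyCompactSpace X] : Function.Injective (expLoopHom X) := by
  rw [injective_iff_map_eq_one]
  intro n hn
  have hcont := n.toAdd.continuous
  refine toAdd_eq_zero.1 (LocallyConstant.ext fun x => ?_)
  have h := lift_eq_of_homotopic (Quotient.exact hn)
    (g := ⟨fun q => (q.1 0 : ℝ) * (n.toAdd q.2 : ℂ), by fun_prop⟩) (g' := 0) (fun _ _ => rfl)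
    (fun _ _ => unitExp_zero) (fun x => by simp) (y := 1) ⟨0, Or.inr rfl⟩ x
  simpa using h

theorem exists_locallyConstant_intCast_eq {f : X → ℂ} (hf : Continuous f)
    (h : ∀ x, ∃ n : ℤ, f x = n) : ∃ n : LocallyConstant X ℤ, ∀ x, f x = n x := by
  choose n hn using h
  have hn' : ((↑) : ℤ → ℂ) ∘ n = f := funext fun x => (hn x).symm
  have hcont : Continuous n :=
    Complex.isClosedEmbedding_intCast.continuous_iff.2 (by rwa [hn'])
  exact ⟨⟨n, (IsLocallyConstant.iff_continuous n).2 hcont⟩, hn⟩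

theorem expLoopHom_surjective [LocallyCompactSpace X] : Function.Surjective (expLoopHom X) := by
  rintro ⟨a⟩
  obtain ⟨g, hg, hg0⟩ := exists_lift_genLoop one_pos a
  have ha1 : a 1 = 1 := a.2 1 ⟨0, Or.inr rfl⟩
  obtain ⟨n, hn⟩ := exists_locallyConstant_intCast_eq (f := fun x => g (1, x)) (by fun_prop)
    fun x => unitExp_eq_one_iff.1 (by rw [hg, ha1, ContinuousMap.one_apply])
  have hcont := n.continuous
  refine ⟨Multiplicative.ofAdd n, Quotient.sound (homotopic_of_lifts
    (g := ⟨fun q => (q.1 0 : ℝ) * (n q.2 : ℂ), by fun_prop⟩) (fun _ _ => rfl) hg ?_)⟩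
  rintro y ⟨i, hi⟩ x
  rw [Subsingleton.elim i 0] at hi
  have hy : ∀ c, y 0 = c → y = fun _ => c := fun c h => funext fun j => by
    rw [Subsingleton.elim j 0, h]
  rcases hi with hi | hi
  · rw [hy 0 hi]
    exact (by simp : ((0 : I) : ℝ) * (n x : ℂ) = 0).trans (hg0 x).symm
  · rw [hy 1 hi]
    exact (by simp : ((1 : I) : ℝ) * (n x : ℂ) = n x).trans (hn x).symm

theorem piHom_precompHom_expLoopHom (f : C(Y, X)) (n : LocallyConstant X ℤ) :
    piHom 0 (precompHom ℂ f) (expLoopHom X (Multiplicative.ofAdd n)) =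
      expLoopHom Y (Multiplicative.ofAdd (n.comap f)) := rfl

end FundamentalGroup

/-! ### Čech classes and cohomology in degree zero -/

section CechLimit

variable {X Y : Type*} [TopologicalSpace X] [TopologicalSpace Y] {M : Type*} [AddCommGroup M]

instance : Nonempty (PtCover X) :=
  ⟨⟨fun _ => Set.univ, fun _ => isOpen_univ, fun _ => Set.mem_univ _⟩⟩

instance : IsDirectedOrder (PtCover X) :=
  ⟨fun U V => ⟨⟨fun x => U.set x ∩ V.set x, fun x => (U.isOpen x).inter (V.isOpen x),
    fun x => ⟨U.mem x, V.mem x⟩⟩, fun _ => Set.inter_subset_left, fun _ => Set.inter_subset_right⟩⟩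

open Classical in
/-- The class in `Ȟ^p(X; M)` of a cocycle on the nerve of `U`. -/
def cechClass (U : PtCover X) {p : ℕ} (c : cocycles U p M) : Cech X p M :=
  AddCommGroup.DirectLimit.of (fun U : PtCover X => NerveCohomology U p M)
    (fun _ _ h => nerveMap id h p M) U (QuotientAddGroup.mk c)

theorem exists_cechClass_eq {p : ℕ} (z : Cech X p M) :
    ∃ (U : PtCover X) (c : cocycles U p M), cechClass U c = z := by
  classical
  refine AddCommGroup.DirectLimit.induction_on
    (G := fun U : PtCover X => NerveCohomology U p M) (f := fun _ _ h => nerveMap id h p M)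
    (C := fun z => ∃ (U : PtCover X) (c : cocycles U p M), cechClass U c = z) z ?_
  intro U x
  obtain ⟨c, rfl⟩ := QuotientAddGroup.mk_surjective x
  exact ⟨U, c, rfl⟩

theorem cechClass_refine {U V : PtCover X} (h : U ≤ V) {p : ℕ} (c : cocycles U p M) :
    cechClass V (cocycleMap id h p M c) = cechClass U c := by
  classical
  exact AddCommGroup.DirectLimit.of_f (G := fun U : PtCover X => NerveCohomology U p M)
    (f := fun _ _ h => nerveMap id h p M) h (QuotientAddGroup.mk c)

theorem cechClass_eq_zero {U : PtCover X} {p : ℕ} {c : cocycles U p M}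
    (h : c.1 ∈ boundaries U p M) : cechClass U c = 0 := by
  have hc : (QuotientAddGroup.mk c : NerveCohomology U p M) = 0 :=
    (QuotientAddGroup.eq_zero_iff _).2 h
  rw [cechClass, hc]
  exact map_zero _

theorem cechMap_cechClass (f : C(Y, X)) {U : PtCover X} {p : ℕ} (c : cocycles U p M) :
    cechMap f p M (cechClass U c) =
      cechClass (U.pullback f) (cocycleMap f (fun _ => subset_rfl) p M c) := by
  classical
  exact AddCommGroup.DirectLimit.lift_of (G := fun U : PtCover X => NerveCohomology U p M)
    (f := fun _ _ h => nerveMap id h p M) _ _ _ U (QuotientAddGroup.mk c)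

open Classical in
/-- The homomorphism on `Ȟ^p(X; M)` given by compatible homomorphisms on cocycles that vanish on
coboundaries. -/
def cechLift {A : Type*} [AddCommGroup A] {p : ℕ} (φ : ∀ U : PtCover X, cocycles U p M →+ A)
    (hb : ∀ U (c : cocycles U p M), c.1 ∈ boundaries U p M → φ U c = 0)
    (hr : ∀ (U V : PtCover X) (h : U ≤ V) (c : cocycles U p M),
      φ V (cocycleMap id h p M c) = φ U c) : Cech X p M →+ A :=
  AddCommGroup.DirectLimit.lift _ _ _
    (fun U => QuotientAddGroup.lift _ (φ U) fun c hc => hb U c hc)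
    fun U V h x => by
      obtain ⟨c, rfl⟩ := QuotientAddGroup.mk_surjective x
      exact hr U V h c

theorem cechLift_cechClass {A : Type*} [AddCommGroup A] {p : ℕ}
    (φ : ∀ U : PtCover X, cocycles U p M →+ A)
    (hb : ∀ U (c : cocycles U p M), c.1 ∈ boundaries U p M → φ U c = 0)
    (hr : ∀ (U V : PtCover X) (h : U ≤ V) (c : cocycles U p M),
      φ V (cocycleMap id h p M c) = φ U c) (U : PtCover X) (c : cocycles U p M) :
    cechLift φ hb hr (cechClass U c) = φ U c := by
  classical
  exact AddCommGroup.DirectLimit.lift_of (G := fun U : PtCover X => NerveCohomology U p M)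
    (f := fun _ _ h => nerveMap id h p M) _ _ _ U (QuotientAddGroup.mk c)

end CechLimit

section LowDimension

variable {X : Type*} [TopologicalSpace X] {M : Type*} [AddCommGroup M]

/-- The `0`-simplex of the nerve of `U` at a point. -/
def vertex (U : PtCover X) (x : X) : Simplex U 0 :=
  ⟨fun _ => x, x, Set.mem_iInter.2 fun _ => U.mem x⟩

/-- The `1`-simplex of the nerve of `U` on two indices whose open sets share the point `w`. -/
def edge {U : PtCover X} {x y w : X} (hx : w ∈ U.set x) (hy : w ∈ U.set y) : Simplex U 1 :=
  ⟨![x, y], w, Set.mem_iInter.2 fun i => by fin_cases i <;> assumption⟩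

/-- The `2`-simplex of the nerve of `U` on three indices whose open sets share the point `w`. -/
def triangle {U : PtCover X} {x y z w : X} (hx : w ∈ U.set x) (hy : w ∈ U.set y)
    (hz : w ∈ U.set z) : Simplex U 2 :=
  ⟨![x, y, z], w, Set.mem_iInter.2 fun i => by fin_cases i <;> assumption⟩

theorem eq_vertex {U : PtCover X} (σ : Simplex U 0) : σ = vertex U (σ.1 0) :=
  Subtype.ext (funext fun i => congrArg σ.1 (Fin.fin_one_eq_zero i))

theorem Simplex.ext_one {U : PtCover X} {σ τ : Simplex U 1} (h0 : σ.1 0 = τ.1 0)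
    (h1 : σ.1 1 = τ.1 1) : σ = τ :=
  Subtype.ext (funext fun i => by fin_cases i <;> assumption)

theorem coboundary_zero_apply {U : PtCover X} (b : Cochain U 0 M) (σ : Simplex U 1) :
    coboundary U 0 M b σ = b (vertex U (σ.1 1)) - b (vertex U (σ.1 0)) := by
  change ∑ i : Fin 2, (-1 : ℤ) ^ (i : ℕ) • b (σ.face i) = _
  rw [Fin.sum_univ_two, eq_vertex (σ.face 0), eq_vertex (σ.face 1)]
  simp only [Fin.val_zero, pow_zero, one_smul, Fin.val_one, pow_one, neg_smul, sub_eq_add_neg]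
  rfl

theorem coboundary_one_apply {U : PtCover X} (c : Cochain U 1 M) (σ : Simplex U 2) :
    coboundary U 1 M c σ = c (σ.face 0) - c (σ.face 1) + c (σ.face 2) := by
  change ∑ i : Fin 3, (-1 : ℤ) ^ (i : ℕ) • c (σ.face i) = _
  rw [Fin.sum_univ_three]
  simp [sub_eq_add_neg]

theorem cocycle_edge {U : PtCover X} (c : cocycles U 1 M) {x y z w : X} (hx : w ∈ U.set x)
    (hy : w ∈ U.set y) (hz : w ∈ U.set z) :
    c.1 (edge hx hz) = c.1 (edge hx hy) + c.1 (edge hy hz) := by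
  have h : coboundary U 1 M c.1 (triangle hx hy hz) = 0 := congrFun c.2 _
  rw [coboundary_one_apply] at h
  have e0 : (triangle hx hy hz).face 0 = edge hy hz := Simplex.ext_one rfl rfl
  have e1 : (triangle hx hy hz).face 1 = edge hx hz := Simplex.ext_one rfl rfl
  have e2 : (triangle hx hy hz).face 2 = edge hx hy := Simplex.ext_one rfl rfl
  rw [e0, e1, e2] at h
  rw [← sub_eq_zero, ← neg_eq_zero, ← h]
  abel

end LowDimension

section DegreeZero

variable {X Y : Type*} [TopologicalSpace X] [TopologicalSpace Y]

theorem isLocallyConstant_cocycle {U : PtCover X} (c : cocycles U 0 ℤ) :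
    IsLocallyConstant fun x => c.1 (vertex U x) := by
  refine (IsLocallyConstant.iff_eventually_eq _).2 fun x => ?_
  filter_upwards [(U.isOpen x).mem_nhds (U.mem x)] with y hy
  have h : coboundary U 0 ℤ c.1 (edge hy (U.mem y)) = 0 := congrFun c.2 _
  rw [coboundary_zero_apply, sub_eq_zero] at h
  exact h

/-- The locally constant function given by a `0`-cocycle. -/
def zeroCocycleHom (U : PtCover X) : cocycles U 0 ℤ →+ LocallyConstant X ℤ where
  toFun c := ⟨fun x => c.1 (vertex U x), isLocallyConstant_cocycle c⟩
  map_zero' := rfl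
  map_add' _ _ := rfl

variable (X) in
/-- The homomorphism from `Ȟ⁰(X; ℤ)` to the locally constant functions on `X`. -/
def cechZeroHom : Cech X 0 ℤ →+ LocallyConstant X ℤ :=
  cechLift zeroCocycleHom
    (fun U c hc => by
      have h0 : c = 0 := Subtype.ext hc
      rw [h0, map_zero])
    fun _ _ _ _ => rfl

theorem cechZeroHom_cechClass (U : PtCover X) (c : cocycles U 0 ℤ) :
    cechZeroHom X (cechClass U c) = zeroCocycleHom U c := cechLift_cechClass _ _ _ U c

theorem cechZeroHom_injective : Function.Injective (cechZeroHom X) := by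
  rw [injective_iff_map_eq_zero]
  intro z hz
  obtain ⟨U, c, rfl⟩ := exists_cechClass_eq z
  rw [cechZeroHom_cechClass] at hz
  refine cechClass_eq_zero ?_
  change c.1 = 0
  funext σ
  rw [eq_vertex σ]
  exact DFunLike.congr_fun hz (σ.1 0)

theorem cechZeroHom_surjective : Function.Surjective (cechZeroHom X) := by
  intro n
  let U : PtCover X := ⟨fun x => {y | n y = n x}, fun x => n.isLocallyConstant.isOpen_fiber _,
    fun _ => rfl⟩
  have hc : coboundary U 0 ℤ (fun σ => n (σ.1 0)) = 0 := by
    funext σ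
    rw [coboundary_zero_apply]
    obtain ⟨w, hw⟩ := σ.2
    have h0 : n w = n (σ.1 0) := Set.mem_iInter.1 hw 0
    have h1 : n w = n (σ.1 1) := Set.mem_iInter.1 hw 1
    exact sub_eq_zero.2 (h1.symm.trans h0)
  exact ⟨cechClass U ⟨_, hc⟩, cechZeroHom_cechClass U ⟨_, hc⟩⟩

theorem cechZeroHom_cechMap (f : C(Y, X)) (z : Cech X 0 ℤ) :
    cechZeroHom Y (cechMap f 0 ℤ z) = (cechZeroHom X z).comap f := by
  obtain ⟨U, c, rfl⟩ := exists_cechClass_eq z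
  rw [cechMap_cechClass, cechZeroHom_cechClass, cechZeroHom_cechClass]
  rfl

end DegreeZero

/-! ### Čech cohomology in degree one -/

section LocalLogarithms

theorem intCast_eq_of_dist_lt_one {m n : ℤ} (h : dist (m : ℂ) n < 1) : m = n := by
  by_contra hne
  rw [Complex.isometry_intCast.dist_eq] at h
  exact (Int.pairwise_one_le_dist hne).not_gt h

theorem unitExp_surjective : Function.Surjective unitExp := fun w =>
  ⟨Complex.log w / (2 * Real.pi * Complex.I), Units.ext <| by
    rw [val_unitExp, mul_div_cancel₀ _ Complex.two_pi_I_ne_zero, Complex.exp_log w.ne_zero]⟩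

theorem exists_local_section_unitExp (w : ℂˣ) {ε : ℝ} (hε : 0 < ε) :
    ∃ (V : Set ℂˣ) (s : ℂˣ → ℂ), IsOpen V ∧ w ∈ V ∧ ContinuousOn s V ∧
      ∀ v ∈ V, unitExp (s v) = v ∧ dist (s v) (s w) < ε := by
  obtain ⟨z, rfl⟩ := unitExp_surjective w
  obtain ⟨e, hz, he⟩ := isCoveringMap_unitExp.isLocalHomeomorph z
  have hsymm : e.symm (unitExp z) = z := by rw [he, e.left_inv hz]
  refine ⟨e.target ∩ e.symm ⁻¹' Metric.ball z ε, e.symm,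
    e.symm.continuousOn.isOpen_inter_preimage e.open_target Metric.isOpen_ball,
    ⟨he ▸ e.map_source hz, ?_⟩, e.symm.continuousOn.mono Set.inter_subset_left,
    fun v hv => ⟨?_, ?_⟩⟩
  · rw [Set.mem_preimage, hsymm]
    exact Metric.mem_ball_self hε
  · rw [he, e.right_inv hv.1]
  · rw [hsymm]
    exact hv.2

variable {X Y : Type*} [TopologicalSpace X] [TopologicalSpace Y] {U : PtCover X}

theorem PtCover.continuous_diag {Z : Type*} [TopologicalSpace Z] {h : X → X → Z}
    (hc : ∀ x, ContinuousOn (h x) (U.set x)) (hd : ∀ x, ∀ w ∈ U.set x, h x w = h w w) :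
    Continuous fun w => h w w :=
  continuous_iff_continuousAt.2 fun x =>
    ((hc x).continuousAt ((U.isOpen x).mem_nhds (U.mem x))).congr <|
      Filter.eventually_of_mem ((U.isOpen x).mem_nhds (U.mem x)) (hd x)

/-- `l x` is a continuous logarithm of `f` on the member of `U` indexed by `x`, for the covering
`unitExp`. -/
structure IsLocalLog (U : PtCover X) (f : C(X, ℂˣ)) (l : X → X → ℂ) : Prop where
  continuousOn : ∀ x, ContinuousOn (l x) (U.set x)
  unitExp_eq : ∀ x, ∀ w ∈ U.set x, unitExp (l x w) = f w

/-- `c` is the family of differences of a choice of logarithms of `f` on the members of `U`: it is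
the obstruction to patching them to a global logarithm. -/
def Represents (U : PtCover X) (c : Cochain U 1 ℤ) (f : C(X, ℂˣ)) : Prop :=
  ∃ l : X → X → ℂ, IsLocalLog U f l ∧
    ∀ (σ : Simplex U 1) (w : X), w ∈ U.set (σ.1 0) → w ∈ U.set (σ.1 1) →
      l (σ.1 0) w - l (σ.1 1) w = c σ

namespace Represents

variable {c c' : Cochain U 1 ℤ} {f f' : C(X, ℂˣ)}

theorem add (h : Represents U c f) (h' : Represents U c' f') :
    Represents U (c + c') (f * f') := by
  obtain ⟨l, hl, hc⟩ := h
  obtain ⟨l', hl', hc'⟩ := h'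
  refine ⟨fun x w => l x w + l' x w,
    ⟨fun x => (hl.continuousOn x).add (hl'.continuousOn x), fun x w hw => ?_⟩, fun σ w h0 h1 => ?_⟩
  · rw [unitExp_add, hl.unitExp_eq x w hw, hl'.unitExp_eq x w hw, ContinuousMap.mul_apply]
  · rw [add_sub_add_comm, hc σ w h0 h1, hc' σ w h0 h1, Pi.add_apply, Int.cast_add]

theorem neg (h : Represents U c f) : Represents U (-c) f⁻¹ := by
  obtain ⟨l, hl, hc⟩ := h
  refine ⟨fun x w => -l x w, ⟨fun x => (hl.continuousOn x).neg, fun x w hw => ?_⟩,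
    fun σ w h0 h1 => ?_⟩
  · rw [unitExp_neg, hl.unitExp_eq x w hw, ContinuousMap.inv_apply]
  · rw [neg_sub_neg, ← neg_sub, hc σ w h0 h1, Pi.neg_apply, Int.cast_neg]

theorem pullback {V : PtCover Y} (h : Represents U c f) (φ : C(Y, X)) (hφ : Subordinate φ V U) :
    Represents V (cochainMap φ hφ 1 ℤ c) (f.comp φ) := by
  obtain ⟨l, hl, hc⟩ := h
  refine ⟨fun y w => l (φ y) (φ w),
    ⟨fun y => (hl.continuousOn (φ y)).comp φ.continuous.continuousOn (hφ y),
      fun y w hw => hl.unitExp_eq _ _ (hφ y hw)⟩, fun σ w h0 h1 => ?_⟩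
  exact hc (σ.map φ hφ) (φ w) (hφ _ h0) (hφ _ h1)

theorem coboundary_eq_zero (h : Represents U c f) : coboundary U 1 ℤ c = 0 := by
  obtain ⟨l, -, hc⟩ := h
  funext σ
  obtain ⟨w, hw⟩ := σ.2
  rw [Set.mem_iInter] at hw
  have h12 : l (σ.1 1) w - l (σ.1 2) w = c (σ.face 0) := hc (σ.face 0) w (hw _) (hw _)
  have h02 : l (σ.1 0) w - l (σ.1 2) w = c (σ.face 1) := hc (σ.face 1) w (hw _) (hw _)
  have h01 : l (σ.1 0) w - l (σ.1 1) w = c (σ.face 2) := hc (σ.face 2) w (hw _) (hw _)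
  rw [coboundary_one_apply, Pi.zero_apply, ← Int.cast_inj (α := ℂ)]
  push_cast
  linear_combination h02 - h12 - h01

theorem joined_of_boundary (h : Represents U c f) (hb : c ∈ boundaries U 1 ℤ) : Joined 1 f := by
  obtain ⟨l, hl, hc⟩ := h
  obtain ⟨b, rfl⟩ := hb
  have hpatch : ∀ x, ∀ w ∈ U.set x, l x w + b (vertex U x) = l w w + b (vertex U w) := by
    intro x w hw
    have hxw : l x w - l w w = (coboundary U 0 ℤ b (edge hw (U.mem w)) : ℤ) :=
      hc (edge hw (U.mem w)) w hw (U.mem w)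
    have hδ : coboundary U 0 ℤ b (edge hw (U.mem w)) = b (vertex U w) - b (vertex U x) :=
      coboundary_zero_apply b _
    rw [hδ, Int.cast_sub] at hxw
    linear_combination hxw
  refine joined_of_eq_unitExp (g := fun w => l w w + b (vertex U w)) (U.continuous_diag
    (h := fun x w => l x w + b (vertex U x))
    (fun x => (hl.continuousOn x).add continuousOn_const) hpatch) fun w => ?_
  rw [unitExp_add, unitExp_intCast, hl.unitExp_eq w w (U.mem w), mul_one, ContinuousMap.one_apply,
    mul_one]

theorem exists_boundary_of_one (h : Represents U c 1) :
    ∃ (V : PtCover X) (hV : U ≤ V), cochainMap id hV 1 ℤ c ∈ boundaries V 1 ℤ := by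
  obtain ⟨l, hl, hc⟩ := h
  have hint : ∀ x, ∀ w ∈ U.set x, ∃ n : ℤ, l x w = n := fun x w hw =>
    unitExp_eq_one_iff.1 (hl.unitExp_eq x w hw)
  let V : PtCover X := ⟨fun x => U.set x ∩ l x ⁻¹' Metric.ball (l x x) 1,
    fun x => (hl.continuousOn x).isOpen_inter_preimage (U.isOpen x) Metric.isOpen_ball,
    fun x => ⟨U.mem x, Metric.mem_ball_self one_pos⟩⟩
  have hUV : U ≤ V := fun _ => Set.inter_subset_left
  choose n hn using fun x => hint x x (U.mem x)
  have hconst : ∀ x, ∀ w ∈ V.set x, l x w = n x := by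
    rintro x w ⟨hw, hball⟩
    obtain ⟨m, hm⟩ := hint x w hw
    rw [Set.mem_preimage, Metric.mem_ball, hm, hn] at hball
    rw [hm, intCast_eq_of_dist_lt_one hball]
  refine ⟨V, hUV, fun σ => -n (σ.1 0), funext fun σ => ?_⟩
  obtain ⟨w, hw⟩ := σ.2
  rw [Set.mem_iInter] at hw
  have hσ : l (σ.1 0) w - l (σ.1 1) w = (cochainMap id hUV 1 ℤ c σ : ℤ) :=
    hc (σ.map id hUV) w (hUV _ (hw 0)) (hUV _ (hw 1))
  rw [hconst _ w (hw 0), hconst _ w (hw 1)] at hσ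
  rw [coboundary_zero_apply, ← Int.cast_inj (α := ℂ), ← hσ]
  change ((-n (σ.1 1) - -n (σ.1 0) : ℤ) : ℂ) = _
  push_cast
  ring

theorem exists_boundary_of_joined [LocallyCompactSpace X] (h : Represents U c f)
    (hf : Joined 1 f) :
    ∃ (V : PtCover X) (hV : U ≤ V), cochainMap id hV 1 ℤ c ∈ boundaries V 1 ℤ := by
  obtain ⟨g, hg⟩ := exists_eq_unitExp_of_joined hf
  have h0 : Represents U 0 f := ⟨fun _ => g, ⟨fun _ => g.continuous.continuousOn,
    fun _ w _ => (hg w).symm⟩, fun _ w _ _ => by simp⟩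
  have h1 : Represents U c 1 := by simpa using h.add h0.neg
  exact h1.exists_boundary_of_one

end Represents

theorem exists_represents_of_sub_eq {c : Cochain U 1 ℤ} {l : X → X → ℂ}
    (hl : ∀ x, ContinuousOn (l x) (U.set x))
    (hc : ∀ (σ : Simplex U 1) (w : X), w ∈ U.set (σ.1 0) → w ∈ U.set (σ.1 1) →
      l (σ.1 0) w - l (σ.1 1) w = c σ) :
    ∃ f, Represents U c f := by
  have hdiag : ∀ x, ∀ w ∈ U.set x, unitExp (l x w) = unitExp (l w w) := fun x w hw =>
    unitExp_eq_iff.2 ⟨_, hc (edge hw (U.mem w)) w hw (U.mem w)⟩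
  exact ⟨⟨fun w => unitExp (l w w), U.continuous_diag (h := fun x w => unitExp (l x w))
    (fun x => continuous_unitExp.comp_continuousOn (hl x)) hdiag⟩, l, ⟨hl, hdiag⟩, hc⟩

open Classical in
/-- A partition of unity `φ` subordinate to `U` turns a cocycle `c` into the coboundary of
`x ↦ ∑ y, φ y • c (x, y)`. -/
theorem exists_continuous_sub_eq_cocycle [NormalSpace X] [ParacompactSpace X]
    (c : cocycles U 1 ℤ) : ∃ l : X → X → ℂ, (∀ x, Continuous (l x)) ∧
      ∀ {x y w : X} (hx : w ∈ U.set x) (hy : w ∈ U.set y),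
        l x w - l y w = c.1 (edge hx hy) := by
  obtain ⟨φ, hφ⟩ := PartitionOfUnity.exists_isSubordinate isClosed_univ U.set U.isOpen
    fun x _ => Set.mem_iUnion.2 ⟨x, U.mem x⟩
  let v : X → X → ℂ := fun x y =>
    if h : ∃ w, w ∈ U.set x ∧ w ∈ U.set y then (c.1 (edge h.choose_spec.1 h.choose_spec.2) : ℂ)
    else 0
  have hv : ∀ {x y w : X} (hx : w ∈ U.set x) (hy : w ∈ U.set y), v x y = c.1 (edge hx hy) :=
    fun {x y w} hx hy => dif_pos (⟨w, hx, hy⟩ : ∃ w, w ∈ U.set x ∧ w ∈ U.set y)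
  have hfin : ∀ x w, (Function.support fun y => φ y w • v x y).Finite := fun x w =>
    (φ.locallyFinite.point_finite w).subset
      (Function.support_smul_subset_left (fun y => φ y w) (v x))
  refine ⟨fun x w => ∑ᶠ y, φ y w • v x y, fun x =>
    φ.continuous_finsum_smul (g := fun y _ => v x y) fun _ _ _ => continuousAt_const, ?_⟩
  intro x x' w hx hx'
  have hterm : ∀ y, φ y w • v x y - φ y w • v x' y = φ y w • (c.1 (edge hx hx') : ℂ) := by
    intro y
    by_cases hy : φ y w = 0
    · simp only [hy, zero_smul, sub_zero]
    · have hyU : w ∈ U.set y := hφ y (subset_tsupport _ hy)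
      rw [← smul_sub, hv hx hyU, hv hx' hyU, cocycle_edge c hx hx' hyU, Int.cast_add,
        add_sub_cancel_right]
  rw [← finsum_sub_distrib (hfin x w) (hfin x' w), finsum_congr hterm, ← finsum_smul,
    φ.sum_eq_one (Set.mem_univ w), one_smul]

theorem exists_represents [NormalSpace X] [ParacompactSpace X] (c : cocycles U 1 ℤ) :
    ∃ f, Represents U c.1 f := by
  obtain ⟨l, hl, hc⟩ := exists_continuous_sub_eq_cocycle c
  exact exists_represents_of_sub_eq (fun x => (hl x).continuousOn) fun σ w h0 h1 =>
    (hc h0 h1).trans (by rw [Simplex.ext_one (σ := edge h0 h1) (τ := σ) rfl rfl])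

theorem exists_isLocalLog (f : C(X, ℂˣ)) {ε : ℝ} (hε : 0 < ε) :
    ∃ (U : PtCover X) (l : X → X → ℂ), IsLocalLog U f l ∧
      ∀ x, ∀ w ∈ U.set x, dist (l x w) (l x x) < ε := by
  choose V s hV hmem hcont hs using fun x => exists_local_section_unitExp (f x) hε
  exact ⟨⟨fun x => f ⁻¹' V x, fun x => (hV x).preimage f.continuous, hmem⟩,
    fun x w => s x (f w), ⟨fun x => (hcont x).comp f.continuous.continuousOn fun _ hw => hw,
      fun x w hw => (hs x (f w) hw).1⟩, fun x w hw => (hs x (f w) hw).2⟩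

theorem exists_cocycle_represents (f : C(X, ℂˣ)) :
    ∃ (U : PtCover X) (c : cocycles U 1 ℤ), Represents U c.1 f := by
  obtain ⟨U, l, hl, hdist⟩ := exists_isLocalLog f (ε := 1 / 4) (by norm_num)
  have hint : ∀ (σ : Simplex U 1) (w : X), w ∈ U.set (σ.1 0) → w ∈ U.set (σ.1 1) →
      ∃ n : ℤ, l (σ.1 0) w - l (σ.1 1) w = n := fun σ w h0 h1 =>
    unitExp_eq_iff.1 ((hl.unitExp_eq _ w h0).trans (hl.unitExp_eq _ w h1).symm)
  have hosc : ∀ {x w w'}, w ∈ U.set x → w' ∈ U.set x → dist (l x w) (l x w') < 1 / 4 + 1 / 4 :=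
    fun {x w w'} hw hw' => (dist_triangle_right _ _ (l x x)).trans_lt
      (add_lt_add (hdist x w hw) (hdist x w' hw'))
  have hmem : ∀ (σ : Simplex U 1) (i), σ.2.choose ∈ U.set (σ.1 i) := fun σ =>
    Set.mem_iInter.1 σ.2.choose_spec
  choose c hc using fun σ : Simplex U 1 => hint σ _ (hmem σ 0) (hmem σ 1)
  have hrep : Represents U c f := by
    refine ⟨l, hl, fun σ w h0 h1 => ?_⟩
    obtain ⟨n, hn⟩ := hint σ w h0 h1
    have hnc : dist (n : ℂ) (c σ) < 1 := by
      rw [← hn, ← hc σ]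
      calc _ ≤ _ := dist_sub_sub_le _ _ _ _
        _ < 1 / 4 + 1 / 4 + (1 / 4 + 1 / 4) := add_lt_add (hosc h0 (hmem σ 0)) (hosc h1 (hmem σ 1))
        _ = 1 := by norm_num
    rw [hn, intCast_eq_of_dist_lt_one hnc]
  exact ⟨U, ⟨c, hrep.coboundary_eq_zero⟩, hrep⟩

end LocalLogarithms

section DegreeOne

variable {X Y : Type*} [TopologicalSpace X] [TopologicalSpace Y] {U : PtCover X}

/-- `π₀` of a commutative topological group as a commutative group. It extends the group structure
of `ZerothHomotopy` and is only used as a local instance. -/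
abbrev zerothHomotopyCommGroup {H : Type*} [CommGroup H] [TopologicalSpace H]
    [IsTopologicalGroup H] : CommGroup (ZerothHomotopy H) where
  __ := (inferInstance : Group (ZerothHomotopy H))
  mul_comm := by
    rintro ⟨a⟩ ⟨b⟩
    exact congrArg ZerothHomotopy.mk (mul_comm a b)

attribute [local instance] zerothHomotopyCommGroup

theorem Represents.mk_eq {c c' : Cochain U 1 ℤ} {f f' : C(X, ℂˣ)}
    (h : Represents U c f) (h' : Represents U c' f') (hc : c - c' ∈ boundaries U 1 ℤ) :
    ZerothHomotopy.mk f = ZerothHomotopy.mk f' := by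
  have hsub : Represents U (c - c') (f * f'⁻¹) := sub_eq_add_neg c c' ▸ h.add h'.neg
  have hone : (1 : ZerothHomotopy C(X, ℂˣ)) = ZerothHomotopy.mk f * (ZerothHomotopy.mk f')⁻¹ :=
    Quotient.sound (hsub.joined_of_boundary hc)
  exact mul_inv_eq_one.1 hone.symm

theorem Represents.mk_eq_mk {c : Cochain U 1 ℤ} {f f' : C(X, ℂˣ)}
    (h : Represents U c f) (h' : Represents U c f') :
    ZerothHomotopy.mk f = ZerothHomotopy.mk f' :=
  h.mk_eq h' (by
    rw [sub_self]
    exact zero_mem _)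

variable [NormalSpace X] [ParacompactSpace X] [NormalSpace Y] [ParacompactSpace Y]

/-- The component of `C(X, ℂˣ)` of the functions represented by a `1`-cocycle. -/
def oneCocycleHom (U : PtCover X) : cocycles U 1 ℤ →+ Additive (ZerothHomotopy C(X, ℂˣ)) :=
  AddMonoidHom.mk' (fun c => Additive.ofMul (ZerothHomotopy.mk (exists_represents c).choose))
    fun c c' => congrArg Additive.ofMul <| (exists_represents (c + c')).choose_spec.mk_eq_mk <|
      (exists_represents c).choose_spec.add (exists_represents c').choose_spec

theorem Represents.oneCocycleHom_eq {c : cocycles U 1 ℤ} {f : C(X, ℂˣ)}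
    (h : Represents U c.1 f) : oneCocycleHom U c = Additive.ofMul (ZerothHomotopy.mk f) :=
  congrArg Additive.ofMul ((exists_represents c).choose_spec.mk_eq_mk h)

variable (X) in
/-- The homomorphism `Ȟ¹(X; ℤ) → π₀ C(X, ℂˣ)`. -/
def cechOneHom : Cech X 1 ℤ →+ Additive (ZerothHomotopy C(X, ℂˣ)) :=
  cechLift oneCocycleHom
    (fun U c hc => by
      obtain ⟨f, hf⟩ := exists_represents c
      rw [hf.oneCocycleHom_eq]
      exact congrArg Additive.ofMul (Quotient.sound (hf.joined_of_boundary hc).symm))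
    fun U V h c => by
      obtain ⟨f, hf⟩ := exists_represents c
      have hf' : Represents V (cocycleMap id h 1 ℤ c).1 f := hf.pullback (ContinuousMap.id X) h
      rw [hf.oneCocycleHom_eq, hf'.oneCocycleHom_eq]

theorem Represents.cechOneHom_cechClass {c : cocycles U 1 ℤ} {f : C(X, ℂˣ)}
    (h : Represents U c.1 f) :
    cechOneHom X (cechClass U c) = Additive.ofMul (ZerothHomotopy.mk f) :=
  (cechLift_cechClass _ _ _ U c).trans h.oneCocycleHom_eq

theorem cechOneHom_injective [LocallyCompactSpace X] : Function.Injective (cechOneHom X) := by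
  rw [injective_iff_map_eq_zero]
  intro z hz
  obtain ⟨U, c, rfl⟩ := exists_cechClass_eq z
  obtain ⟨f, hf⟩ := exists_represents c
  rw [hf.cechOneHom_cechClass] at hz
  have hj : Joined f 1 := Quotient.exact (Additive.ofMul.injective hz)
  obtain ⟨V, hV, hb⟩ := hf.exists_boundary_of_joined hj.symm
  rw [← cechClass_refine hV]
  exact cechClass_eq_zero hb

theorem cechOneHom_surjective : Function.Surjective (cechOneHom X) := by
  intro z
  obtain ⟨⟨f⟩, rfl⟩ := Additive.ofMul.surjective z
  obtain ⟨U, c, hc⟩ := exists_cocycle_represents f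
  exact ⟨_, hc.cechOneHom_cechClass⟩

theorem cechOneHom_cechMap (f : C(Y, X)) (z : Cech X 1 ℤ) :
    (cechOneHom Y (cechMap f 1 ℤ z)).toMul =
      pi0Hom (precompHom ℂ f) (cechOneHom X z).toMul := by
  obtain ⟨U, c, rfl⟩ := exists_cechClass_eq z
  obtain ⟨g, hg⟩ := exists_represents c
  have hg' : Represents (U.pullback f) (cocycleMap f (fun _ => subset_rfl) 1 ℤ c).1 (g.comp f) :=
    hg.pullback f _
  rw [cechMap_cechClass, hg.cechOneHom_cechClass, hg'.cechOneHom_cechClass]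
  rfl

end DegreeOne

/-! ### Homotopy of `C(X, ℂˣ)` and Čech cohomology -/

section CechEquiv

/-- The isomorphism `Ȟ⁰(X; ℤ) ≅ π₁(C(X, ℂˣ))` sending a locally constant function `n` to the class
of the loop `t ↦ exp (2πi n t)`. -/
def cechZeroEquiv (X : Type*) [TopologicalSpace X] [LocallyCompactSpace X] :
    Multiplicative (Cech X 0 ℤ) ≃* π_ 1 C(X, ℂˣ) 1 :=
  MulEquiv.ofBijective ((expLoopHom X).comp (AddMonoidHom.toMultiplicative (cechZeroHom X)))
    ⟨expLoopHom_injective.comp cechZeroHom_injective,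
      expLoopHom_surjective.comp cechZeroHom_surjective⟩

/-- The isomorphism `Ȟ¹(X; ℤ) ≅ π₀(C(X, ℂˣ))` sending a cocycle to the class of the functions
whose local logarithms differ by it. -/
def cechOneEquiv (X : Type*) [TopologicalSpace X] [LocallyCompactSpace X] [NormalSpace X]
    [ParacompactSpace X] : Multiplicative (Cech X 1 ℤ) ≃* ZerothHomotopy C(X, ℂˣ) :=
  MulEquiv.ofBijective (AddMonoidHom.toMultiplicativeLeft (cechOneHom X))
    ⟨cechOneHom_injective, cechOneHom_surjective⟩

variable {X Y : Type*} [TopologicalSpace X] [LocallyCompactSpace X] [TopologicalSpace Y]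
  [LocallyCompactSpace Y]

theorem cechZeroEquiv_cechMul (f : C(Y, X)) (z : Multiplicative (Cech X 0 ℤ)) :
    cechZeroEquiv Y (cechMul f 0 z) = piHom 0 (precompHom ℂ f) (cechZeroEquiv X z) := by
  change expLoopHom Y (Multiplicative.ofAdd (cechZeroHom Y (cechMap f 0 ℤ z.toAdd))) = _
  rw [cechZeroHom_cechMap, ← piHom_precompHom_expLoopHom]
  rfl

theorem cechOneEquiv_cechMul [NormalSpace X] [ParacompactSpace X] [NormalSpace Y]
    [ParacompactSpace Y] (f : C(Y, X)) (z : Multiplicative (Cech X 1 ℤ)) :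
    cechOneEquiv Y (cechMul f 1 z) = pi0Hom (precompHom ℂ f) (cechOneEquiv X z) :=
  cechOneHom_cechMap f z.toAdd

end CechEquiv

/-! ### Naturality -/

section Squares

variable {A A' C C' D D' : Type*} [Group A] [Group A'] [Group C] [Group C'] [Group D] [Group D']

theorem comp_comp_eq_comp_comp {f : A →* A'} {g : C →* C'} {h : D →* D'} {b : A →* C}
    {b' : A' →* C'} {a : C →* D} {a' : C' →* D'} (hb : b'.comp f = g.comp b)
    (ha : a'.comp g = h.comp a) : (a'.comp b').comp f = h.comp (a.comp b) := by
  rw [MonoidHom.comp_assoc, hb, ← MonoidHom.comp_assoc, ha, MonoidHom.comp_assoc]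

theorem symm_comp_eq {θ : A ≃* C} {θ' : A' ≃* C'} {f : A →* A'} {g : C →* C'}
    (h : ∀ x, θ' (f x) = g (θ x)) :
    θ'.symm.toMonoidHom.comp g = f.comp θ.symm.toMonoidHom := by
  ext x
  obtain ⟨y, rfl⟩ := θ.surjective x
  change θ'.symm (g (θ y)) = f (θ.symm (θ y))
  rw [← h, θ'.symm_apply_apply, θ.symm_apply_apply]

end Squares

end SectionGL

end

theorem mainTheorem8_general :
    ((∀ (X Y : Type u) [TopologicalSpace X] [LocallyCompactSpace X] [NormalSpace X]
        [ParacompactSpace X] [TopologicalSpace Y] [LocallyCompactSpace Y] [NormalSpace Y]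
        [ParacompactSpace Y] (f : C(Y, X)),
        (cechOneEquiv Y).symm.toMonoidHom.comp (pi0Hom (precompHom ℂ f)) =
          (cechMul f 1).comp (cechOneEquiv X).symm.toMonoidHom ∧
        (cechZeroEquiv Y).symm.toMonoidHom.comp (piHom 0 (precompHom ℂ f)) =
          (cechMul f 0).comp (cechZeroEquiv X).symm.toMonoidHom) ∧
      (∀ (G : Type w) [Group G] [TopologicalSpace G] [IsTopologicalGroup G]
      (X : Type u) [TopologicalSpace X] [LocallyCompactSpace X] [NormalSpace X]
      [ParacompactSpace X]
      (P : Type v) [TopologicalSpace P] [MulAction G P] [ContinuousSMul G P]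
      (ζ : PrincipalBundle G P X)
      (B : Type z) [NonUnitalRing B] [TopologicalSpace B] [IsTopologicalRing B]
      [Module ℂ B] [IsScalarTower ℂ B B] [SMulCommClass ℂ B B] [ContinuousSMul ℂ B]
      [DistribMulAction G B] [ContinuousSMul G B] [MulAct G B] [SMulCommClass G ℂ B],
        IsSplitShortExact (pi0Hom (glIncl ℂ ζ B)) (quot0 ζ B (cechOneEquiv X).symm)
          (split0 ζ B (cechOneEquiv X).symm) ∧
        IsSplitShortExact (piHom 0 (glIncl ℂ ζ B)) (quot1 ζ B (cechZeroEquiv X).symm)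
          (split1 ζ B (cechZeroEquiv X).symm)) ∧
      (∀ (G : Type w) [Group G] [TopologicalSpace G] [IsTopologicalGroup G]
      (X : Type u) [TopologicalSpace X] [LocallyCompactSpace X] [NormalSpace X]
      [ParacompactSpace X]
      (P : Type v) [TopologicalSpace P] [MulAction G P] [ContinuousSMul G P]
      (ζ : PrincipalBundle G P X)
      (B : Type z) [NonUnitalRing B] [TopologicalSpace B] [IsTopologicalRing B]
      [Module ℂ B] [IsScalarTower ℂ B B] [SMulCommClass ℂ B B] [ContinuousSMul ℂ B]
      [DistribMulAction G B] [ContinuousSMul G B] [MulAct G B] [SMulCommClass G ℂ B]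
      (X' : Type u) [TopologicalSpace X'] [LocallyCompactSpace X'] [NormalSpace X']
      [ParacompactSpace X']
      (P' : Type v) [TopologicalSpace P'] [MulAction G P'] [ContinuousSMul G P']
      (ζ' : PrincipalBundle G P' X')
      (B' : Type z) [NonUnitalRing B'] [TopologicalSpace B'] [IsTopologicalRing B']
      [Module ℂ B'] [IsScalarTower ℂ B' B'] [SMulCommClass ℂ B' B'] [ContinuousSMul ℂ B']
      [DistribMulAction G B'] [ContinuousSMul G B'] [MulAct G B'] [SMulCommClass G ℂ B']
      (m : BundleMap ζ' ζ) (α : EquivariantHom ℂ G B B'),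
        ((pi0Hom (glIncl ℂ ζ' B')).comp (pi0Hom (glMap m α)) =
            (pi0Hom (glPlusMap m α)).comp (pi0Hom (glIncl ℂ ζ B)) ∧
          (quot0 ζ' B' (cechOneEquiv X').symm).comp (pi0Hom (glPlusMap m α)) =
            (cechMul m.base 1).comp (quot0 ζ B (cechOneEquiv X).symm) ∧
          (split0 ζ' B' (cechOneEquiv X').symm).comp (cechMul m.base 1) =
            (pi0Hom (glPlusMap m α)).comp (split0 ζ B (cechOneEquiv X).symm)) ∧
        ((piHom 0 (glIncl ℂ ζ' B')).comp (piHom 0 (glMap m α)) =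
            (piHom 0 (glPlusMap m α)).comp (piHom 0 (glIncl ℂ ζ B)) ∧
          (quot1 ζ' B' (cechZeroEquiv X').symm).comp (piHom 0 (glPlusMap m α)) =
            (cechMul m.base 0).comp (quot1 ζ B (cechZeroEquiv X).symm) ∧
          (split1 ζ' B' (cechZeroEquiv X').symm).comp (cechMul m.base 0) =
            (piHom 0 (glPlusMap m α)).comp (split1 ζ B (cechZeroEquiv X).symm)))) ∧
    (∀ (k : ℕ), 2 ≤ k + 1 →
      (∀ (G : Type w) [Group G] [TopologicalSpace G] [IsTopologicalGroup G]
      (X : Type u) [TopologicalSpace X] [LocallyCompactSpace X]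
      (P : Type v) [TopologicalSpace P] [MulAction G P] [ContinuousSMul G P]
      (ζ : PrincipalBundle G P X)
      (B : Type z) [NonUnitalRing B] [TopologicalSpace B] [IsTopologicalRing B]
      [Module ℂ B] [IsScalarTower ℂ B B] [SMulCommClass ℂ B B] [ContinuousSMul ℂ B]
      [DistribMulAction G B] [ContinuousSMul G B] [MulAct G B] [SMulCommClass G ℂ B],
        Function.Bijective (piHom k (idComponentMap (glIncl ℂ ζ B)))) ∧
      (∀ (G : Type w) [Group G] [TopologicalSpace G] [IsTopologicalGroup G]
      (X : Type u) [TopologicalSpace X] [LocallyCompactSpace X]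
      (P : Type v) [TopologicalSpace P] [MulAction G P] [ContinuousSMul G P]
      (ζ : PrincipalBundle G P X)
      (B : Type z) [NonUnitalRing B] [TopologicalSpace B] [IsTopologicalRing B]
      [Module ℂ B] [IsScalarTower ℂ B B] [SMulCommClass ℂ B B] [ContinuousSMul ℂ B]
      [DistribMulAction G B] [ContinuousSMul G B] [MulAct G B] [SMulCommClass G ℂ B]
      (X' : Type u) [TopologicalSpace X'] [LocallyCompactSpace X']
      (P' : Type v) [TopologicalSpace P'] [MulAction G P'] [ContinuousSMul G P']
      (ζ' : PrincipalBundle G P' X')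
      (B' : Type z) [NonUnitalRing B'] [TopologicalSpace B'] [IsTopologicalRing B']
      [Module ℂ B'] [IsScalarTower ℂ B' B'] [SMulCommClass ℂ B' B'] [ContinuousSMul ℂ B']
      [DistribMulAction G B'] [ContinuousSMul G B'] [MulAct G B'] [SMulCommClass G ℂ B']
      (m : BundleMap ζ' ζ) (α : EquivariantHom ℂ G B B'),
        (piHom k (idComponentMap (glIncl ℂ ζ' B'))).comp (piHom k (idComponentMap (glMap m α))) =
          (piHom k (idComponentMap (glPlusMap m α))).comp
            (piHom k (idComponentMap (glIncl ℂ ζ B))))) ∧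
    (∀ (k : ℕ),
      (∀ (G : Type w) [Group G] [TopologicalSpace G] [IsTopologicalGroup G]
      (X : Type u) [TopologicalSpace X] [LocallyCompactSpace X]
      (P : Type v) [TopologicalSpace P] [MulAction G P] [ContinuousSMul G P]
      (ζ : PrincipalBundle G P X)
      (B : Type z) [NonUnitalRing B] [TopologicalSpace B] [IsTopologicalRing B]
      [Module ℝ B] [IsScalarTower ℝ B B] [SMulCommClass ℝ B B] [ContinuousSMul ℝ B]
      [DistribMulAction G B] [ContinuousSMul G B] [MulAct G B] [SMulCommClass G ℝ B],
        Function.Bijective (piHom k (idComponentMap (glIncl ℝ ζ B)))) ∧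
      (∀ (G : Type w) [Group G] [TopologicalSpace G] [IsTopologicalGroup G]
      (X : Type u) [TopologicalSpace X] [LocallyCompactSpace X]
      (P : Type v) [TopologicalSpace P] [MulAction G P] [ContinuousSMul G P]
      (ζ : PrincipalBundle G P X)
      (B : Type z) [NonUnitalRing B] [TopologicalSpace B] [IsTopologicalRing B]
      [Module ℝ B] [IsScalarTower ℝ B B] [SMulCommClass ℝ B B] [ContinuousSMul ℝ B]
      [DistribMulAction G B] [ContinuousSMul G B] [MulAct G B] [SMulCommClass G ℝ B]
      (X' : Type u) [TopologicalSpace X'] [LocallyCompactSpace X']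
      (P' : Type v) [TopologicalSpace P'] [MulAction G P'] [ContinuousSMul G P']
      (ζ' : PrincipalBundle G P' X')
      (B' : Type z) [NonUnitalRing B'] [TopologicalSpace B'] [IsTopologicalRing B']
      [Module ℝ B'] [IsScalarTower ℝ B' B'] [SMulCommClass ℝ B' B'] [ContinuousSMul ℝ B']
      [DistribMulAction G B'] [ContinuousSMul G B'] [MulAct G B'] [SMulCommClass G ℝ B']
      (m : BundleMap ζ' ζ) (α : EquivariantHom ℝ G B B'),
        (piHom k (idComponentMap (glIncl ℝ ζ' B'))).comp (piHom k (idComponentMap (glMap m α))) =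
          (piHom k (idComponentMap (glPlusMap m α))).comp
            (piHom k (idComponentMap (glIncl ℝ ζ B))))) := by
  refine ⟨⟨?_, ?_, ?_⟩, fun k hk => ⟨?_, ?_⟩, fun k => ⟨?_, ?_⟩⟩
  · intro X Y _ _ _ _ _ _ _ _ f
    exact ⟨symm_comp_eq (cechOneEquiv_cechMul f), symm_comp_eq (cechZeroEquiv_cechMul f)⟩
  · intro G _ _ _ X _ _ _ _ P _ _ _ ζ B _ _ _ _ _ _ _ _ _ _ _
    have h := isDirectDecomposition_gl ℂ ζ B
    exact ⟨h.pi0.isSplitShortExact _, (h.pi 0).isSplitShortExact _⟩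
  · intro G _ _ _ X _ _ _ _ P _ _ _ ζ B _ _ _ _ _ _ _ _ _ _ _ X' _ _ _ _ P' _ _ _ ζ' B'
      _ _ _ _ _ _ _ _ _ _ _ m α
    have h₀ := symm_comp_eq (cechOneEquiv_cechMul m.base)
    have h₁ := symm_comp_eq (cechZeroEquiv_cechMul m.base)
    have hp := glProj_comp_glPlusMap m α
    have hs := glScalar_comp_precompHom m α
    exact ⟨⟨pi0Hom_comp_eq (glIncl_comp_glMap m α),
        comp_comp_eq_comp_comp (pi0Hom_comp_eq hp) h₀,
        comp_comp_eq_comp_comp (symm_comp_eq (DFunLike.congr_fun h₀)) (pi0Hom_comp_eq hs)⟩,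
      piHom_comp_eq 0 (glIncl_comp_glMap m α),
      comp_comp_eq_comp_comp (piHom_comp_eq 0 hp) h₁,
      comp_comp_eq_comp_comp (symm_comp_eq (DFunLike.congr_fun h₁)) (piHom_comp_eq 0 hs)⟩
  · intro G _ _ _ X _ _ P _ _ _ ζ B _ _ _ _ _ _ _ _ _ _ _
    have := subsingleton_pi_complex (X := X) hk
    exact (isDirectDecomposition_gl ℂ ζ B).bijective_piHom_idComponentMap k
  · intro G _ _ _ X _ _ P _ _ _ ζ B _ _ _ _ _ _ _ _ _ _ _ X' _ _ P' _ _ _ ζ' B'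
      _ _ _ _ _ _ _ _ _ _ _ m α
    exact piHom_comp_eq k (idComponentMap_comp_eq (glIncl_comp_glMap m α))
  · intro G _ _ _ X _ _ P _ _ _ ζ B _ _ _ _ _ _ _ _ _ _ _
    have := subsingleton_pi_real (X := X) k.succ_pos
    exact (isDirectDecomposition_gl ℝ ζ B).bijective_piHom_idComponentMap k
  · intro G _ _ _ X _ _ P _ _ _ ζ B _ _ _ _ _ _ _ _ _ _ _ X' _ _ P' _ _ _ ζ' B'
      _ _ _ _ _ _ _ _ _ _ _ m α
    exact piHom_comp_eq k (idComponentMap_comp_eq (glIncl_comp_glMap m α))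

theorem mainTheorem8 :
    -- complex case, `j = 0, 1`
    (∃ (θ₀ : ∀ (X : Type u) [MetricSpace X] [CompactSpace X],
          ZerothHomotopy C(X, ℂˣ) ≃* Multiplicative (Cech X 1 ℤ))
        (θ₁ : ∀ (X : Type u) [MetricSpace X] [CompactSpace X],
          π_ 1 C(X, ℂˣ) 1 ≃* Multiplicative (Cech X 0 ℤ)),
      -- the identifications of the homotopy of `C(X, ℂ - 0)` are natural in `X`
      (∀ (X Y : Type u) [MetricSpace X] [CompactSpace X] [MetricSpace Y] [CompactSpace Y]
        (f : C(Y, X)),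
        (θ₀ Y).toMonoidHom.comp (pi0Hom (precompHom ℂ f)) =
          (cechMul f 1).comp (θ₀ X).toMonoidHom ∧
        (θ₁ Y).toMonoidHom.comp (piHom 0 (precompHom ℂ f)) =
          (cechMul f 0).comp (θ₁ X).toMonoidHom) ∧
      -- the split short exact sequences
      (∀ (G : Type w) [Group G] [TopologicalSpace G] [IsTopologicalGroup G]
      (X : Type u) [MetricSpace X] [CompactSpace X]
      (P : Type v) [TopologicalSpace P] [MulAction G P] [ContinuousSMul G P]
      (ζ : PrincipalBundle G P X)
      (B : Type z) [NonUnitalNormedRing B] [NormedSpace ℂ B] [IsScalarTower ℂ B B]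
      [SMulCommClass ℂ B B] [CompleteSpace B]
      [DistribMulAction G B] [ContinuousSMul G B] [MulAct G B] [SMulCommClass G ℂ B],
        IsSplitShortExact (pi0Hom (glIncl ℂ ζ B)) (quot0 ζ B (θ₀ X)) (split0 ζ B (θ₀ X)) ∧
        IsSplitShortExact (piHom 0 (glIncl ℂ ζ B)) (quot1 ζ B (θ₁ X)) (split1 ζ B (θ₁ X))) ∧
      -- their naturality
      (∀ (G : Type w) [Group G] [TopologicalSpace G] [IsTopologicalGroup G]
      (X : Type u) [MetricSpace X] [CompactSpace X]
      (P : Type v) [TopologicalSpace P] [MulAction G P] [ContinuousSMul G P]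
      (ζ : PrincipalBundle G P X)
      (B : Type z) [NonUnitalNormedRing B] [NormedSpace ℂ B] [IsScalarTower ℂ B B]
      [SMulCommClass ℂ B B] [CompleteSpace B]
      [DistribMulAction G B] [ContinuousSMul G B] [MulAct G B] [SMulCommClass G ℂ B]
      (X' : Type u) [MetricSpace X'] [CompactSpace X']
      (P' : Type v) [TopologicalSpace P'] [MulAction G P'] [ContinuousSMul G P']
      (ζ' : PrincipalBundle G P' X')
      (B' : Type z) [NonUnitalNormedRing B'] [NormedSpace ℂ B'] [IsScalarTower ℂ B' B']
      [SMulCommClass ℂ B' B'] [CompleteSpace B']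
      [DistribMulAction G B'] [ContinuousSMul G B'] [MulAct G B'] [SMulCommClass G ℂ B']
      (m : BundleMap ζ' ζ) (α : EquivariantHom ℂ G B B'),
        ((pi0Hom (glIncl ℂ ζ' B')).comp (pi0Hom (glMap m α)) =
            (pi0Hom (glPlusMap m α)).comp (pi0Hom (glIncl ℂ ζ B)) ∧
          (quot0 ζ' B' (θ₀ X')).comp (pi0Hom (glPlusMap m α)) =
            (cechMul m.base 1).comp (quot0 ζ B (θ₀ X)) ∧
          (split0 ζ' B' (θ₀ X')).comp (cechMul m.base 1) =
            (pi0Hom (glPlusMap m α)).comp (split0 ζ B (θ₀ X))) ∧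
        ((piHom 0 (glIncl ℂ ζ' B')).comp (piHom 0 (glMap m α)) =
            (piHom 0 (glPlusMap m α)).comp (piHom 0 (glIncl ℂ ζ B)) ∧
          (quot1 ζ' B' (θ₁ X')).comp (piHom 0 (glPlusMap m α)) =
            (cechMul m.base 0).comp (quot1 ζ B (θ₁ X)) ∧
          (split1 ζ' B' (θ₁ X')).comp (cechMul m.base 0) =
            (piHom 0 (glPlusMap m α)).comp (split1 ζ B (θ₁ X))))) ∧
    -- complex case, `j = k + 1 ≥ 2`: natural isomorphisms of homotopy groups
    (∀ (k : ℕ), 2 ≤ k + 1 →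
      (∀ (G : Type w) [Group G] [TopologicalSpace G] [IsTopologicalGroup G]
      (X : Type u) [MetricSpace X] [CompactSpace X]
      (P : Type v) [TopologicalSpace P] [MulAction G P] [ContinuousSMul G P]
      (ζ : PrincipalBundle G P X)
      (B : Type z) [NonUnitalNormedRing B] [NormedSpace ℂ B] [IsScalarTower ℂ B B]
      [SMulCommClass ℂ B B] [CompleteSpace B]
      [DistribMulAction G B] [ContinuousSMul G B] [MulAct G B] [SMulCommClass G ℂ B],
        Function.Bijective (piHom k (idComponentMap (glIncl ℂ ζ B)))) ∧
      (∀ (G : Type w) [Group G] [TopologicalSpace G] [IsTopologicalGroup G]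
      (X : Type u) [MetricSpace X] [CompactSpace X]
      (P : Type v) [TopologicalSpace P] [MulAction G P] [ContinuousSMul G P]
      (ζ : PrincipalBundle G P X)
      (B : Type z) [NonUnitalNormedRing B] [NormedSpace ℂ B] [IsScalarTower ℂ B B]
      [SMulCommClass ℂ B B] [CompleteSpace B]
      [DistribMulAction G B] [ContinuousSMul G B] [MulAct G B] [SMulCommClass G ℂ B]
      (X' : Type u) [MetricSpace X'] [CompactSpace X']
      (P' : Type v) [TopologicalSpace P'] [MulAction G P'] [ContinuousSMul G P']
      (ζ' : PrincipalBundle G P' X')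
      (B' : Type z) [NonUnitalNormedRing B'] [NormedSpace ℂ B'] [IsScalarTower ℂ B' B']
      [SMulCommClass ℂ B' B'] [CompleteSpace B']
      [DistribMulAction G B'] [ContinuousSMul G B'] [MulAct G B'] [SMulCommClass G ℂ B']
      (m : BundleMap ζ' ζ) (α : EquivariantHom ℂ G B B'),
        (piHom k (idComponentMap (glIncl ℂ ζ' B'))).comp (piHom k (idComponentMap (glMap m α))) =
          (piHom k (idComponentMap (glPlusMap m α))).comp
            (piHom k (idComponentMap (glIncl ℂ ζ B))))) ∧
    -- real case, `j = k + 1 ≥ 1`: natural isomorphisms of homotopy groups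
    (∀ (k : ℕ), 1 ≤ k + 1 →
      (∀ (G : Type w) [Group G] [TopologicalSpace G] [IsTopologicalGroup G]
      (X : Type u) [MetricSpace X] [CompactSpace X]
      (P : Type v) [TopologicalSpace P] [MulAction G P] [ContinuousSMul G P]
      (ζ : PrincipalBundle G P X)
      (B : Type z) [NonUnitalNormedRing B] [NormedSpace ℝ B] [IsScalarTower ℝ B B]
      [SMulCommClass ℝ B B] [CompleteSpace B]
      [DistribMulAction G B] [ContinuousSMul G B] [MulAct G B] [SMulCommClass G ℝ B],
        Function.Bijective (piHom k (idComponentMap (glIncl ℝ ζ B)))) ∧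
      (∀ (G : Type w) [Group G] [TopologicalSpace G] [IsTopologicalGroup G]
      (X : Type u) [MetricSpace X] [CompactSpace X]
      (P : Type v) [TopologicalSpace P] [MulAction G P] [ContinuousSMul G P]
      (ζ : PrincipalBundle G P X)
      (B : Type z) [NonUnitalNormedRing B] [NormedSpace ℝ B] [IsScalarTower ℝ B B]
      [SMulCommClass ℝ B B] [CompleteSpace B]
      [DistribMulAction G B] [ContinuousSMul G B] [MulAct G B] [SMulCommClass G ℝ B]
      (X' : Type u) [MetricSpace X'] [CompactSpace X']
      (P' : Type v) [TopologicalSpace P'] [MulAction G P'] [ContinuousSMul G P']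
      (ζ' : PrincipalBundle G P' X')
      (B' : Type z) [NonUnitalNormedRing B'] [NormedSpace ℝ B'] [IsScalarTower ℝ B' B']
      [SMulCommClass ℝ B' B'] [CompleteSpace B']
      [DistribMulAction G B'] [ContinuousSMul G B'] [MulAct G B'] [SMulCommClass G ℝ B']
      (m : BundleMap ζ' ζ) (α : EquivariantHom ℝ G B B'),
        (piHom k (idComponentMap (glIncl ℝ ζ' B'))).comp (piHom k (idComponentMap (glMap m α))) =
          (piHom k (idComponentMap (glPlusMap m α))).comp
            (piHom k (idComponentMap (glIncl ℝ ζ B))))) := by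
  have h := mainTheorem8_general.{u, v, w, z}
  exact ⟨⟨fun X => (cechOneEquiv X).symm, fun X => (cechZeroEquiv X).symm,
      fun X Y _ _ _ _ f => h.1.1 X Y f,
      fun G _ _ _ X _ _ P _ _ _ ζ B _ _ _ _ _ _ _ _ _ => h.1.2.1 G X P ζ B,
      fun G _ _ _ X _ _ P _ _ _ ζ B _ _ _ _ _ _ _ _ _ X' _ _ P' _ _ _ ζ' B' _ _ _ _ _ _ _ _ _ =>
        h.1.2.2 G X P ζ B X' P' ζ' B'⟩,
    fun k hk => ⟨fun G _ _ _ X _ _ P _ _ _ ζ B _ _ _ _ _ _ _ _ _ => (h.2.1 k hk).1 G X P ζ B,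
      fun G _ _ _ X _ _ P _ _ _ ζ B _ _ _ _ _ _ _ _ _ X' _ _ P' _ _ _ ζ' B' _ _ _ _ _ _ _ _ _ =>
        (h.2.1 k hk).2 G X P ζ B X' P' ζ' B'⟩,
    fun k _ => ⟨fun G _ _ _ X _ _ P _ _ _ ζ B _ _ _ _ _ _ _ _ _ => (h.2.2 k).1 G X P ζ B,
      fun G _ _ _ X _ _ P _ _ _ ζ B _ _ _ _ _ _ _ _ _ X' _ _ P' _ _ _ ζ' B' _ _ _ _ _ _ _ _ _ =>
        (h.2.2 k).2 G X P ζ B X' P' ζ' B'⟩⟩
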